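/- Let $N\ge 1$, let $S=\begin{pmatrix}0&1_N\\-1_N&0\end{pmatrix}$, and let $\theta\in\mathbb R$. For Schwartz functions $f,h\in\mathcal S(\mathbb R^{2N})$ let $$(f\star_\theta h)(x)=(2\pi)^{-2N}\int\!\!\int f\bigl(x-\tfrac{\theta}{2}Su\bigr)\,h(x+t)\,e^{-iu\cdot t}\,d^{2N}t\,d^{2N}u$$ be the Moyal product (for $\theta=0$ the iterated integral is the pointwise product). Let $\mathcal H=L^2(\mathbb R^{2N})\otimes\mathbb C^{2^N}$, and for $f\in\mathcal S(\mathbb R^{2N})$ let $\pi^\theta(f)$ be the bounded operator on $\mathcal H$ that extends componentwise left Moyal multiplication $\Psi\mapsto f\star_\theta\Psi$ of Schwartz spinors; write $f^*$ for the complex conjugate of $f$. Let $\gamma^1,\dots,\gamma^{2N}$ be hermitian $2^N\times 2^N$ matrices with $\gamma^\mu\gamma^\nu+\gamma^\nu\gamma^\mu=2\delta^{\mu\nu}$, let $D=-i\sum_\mu\gamma^\mu\partial_\mu$ be the self-adjoint Dirac operator on $\mathcal H$ (with domain all $\Psi\in\mathcal H$ whose distributional image $D\Psi$ lies in $\mathcal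 H$), let $|D|=(D^*D)^{1/2}$, and let $\varepsilon>0$. For $p\ge1$, let $\mathcal L^{p+}(\mathcal H)$ denote the weak Schatten class of compact operators $T$ on $\mathcal H$ whose singular values (the eigenvalues of $(T^*T)^{1/2}$ in decreasing order, counted with multiplicity) satisfy $\mu_m(T)=O(m^{-1/p})$ as $m\to\infty$. Then, for every $f\in\mathcal S(\mathbb R^{2N})$, $$\pi^\theta(f)\,(|D|+\varepsilon)^{-1}\,\pi^\theta(f^*)\in\mathcal L^{2N+}(\mathcal H).$$ -/

import Mathlib

open MeasureTheory Filter Asymptotics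
open scoped SchwartzMap LineDeriv ENNReal FourierTransform

noncomputable section

namespace Moyal

/-! ### The Moyal product -/

/-- The Euclidean space `ℝ^{2N}`, with coordinates `(x_1, …, x_N, x_{N+1}, …, x_{2N})`. -/
abbrev Plane (N : ℕ) : Type := EuclideanSpace ℝ (Fin N ⊕ Fin N)

/-- The linear map of the matrix `S = [[0, 1_N], [-1_N, 0]]`. -/
def symp (N : ℕ) : Plane N →L[ℝ] Plane N :=
  Matrix.toEuclideanCLM (n := Fin N ⊕ Fin N) (𝕜 := ℝ) (Matrix.fromBlocks 0 1 (-1) 0)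

/-- The Moyal product with deformation matrix `θ S`:
`(f ⋆ h)(x) = (2π)^{-2N} ∬ f (x - (θ/2) S u) h (x + t) e^{-i u·t} dt du`
(for `θ ≠ 0` and Schwartz functions the double integral converges absolutely; for `θ = 0` the
iterated integral is the pointwise product). -/
def moyalProd {N : ℕ} (θ : ℝ) (f h : Plane N → ℂ) (x : Plane N) : ℂ :=
  ((2 * Real.pi : ℝ) : ℂ)⁻¹ ^ (2 * N) *
    ∫ u : Plane N, ∫ t : Plane N,
      f (x - (θ / 2) • symp N u) * h (x + t) * Complex.exp (-(Complex.I * (inner ℝ u t : ℝ)))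

/-- Complex conjugation of Schwartz functions, `f ↦ f^*`. -/
def conj {N : ℕ} (f : 𝓢(Plane N, ℂ)) : 𝓢(Plane N, ℂ) :=
  SchwartzMap.postcompCLM (𝕜 := ℝ) (Complex.conjCLE : ℂ →L[ℝ] ℂ) f

/-! ### Spinors -/

/-- The spinor fibre `ℂ^{2^N}`. -/
abbrev Fibre (N : ℕ) : Type := EuclideanSpace ℂ (Fin (2 ^ N))

/-- The Hilbert space of square-integrable spinors, `L²(ℝ^{2N}) ⊗ ℂ^{2^N} = L²(ℝ^{2N}; ℂ^{2^N})`. -/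
abbrev Spinors (N : ℕ) : Type := Lp (Fibre N) 2 (volume : Measure (Plane N))

/-- Componentwise left Moyal multiplication of a spinor field by `f`. -/
def starSpinor {N : ℕ} (θ : ℝ) (f : Plane N → ℂ) (Ψ : Plane N → Fibre N) : Plane N → Fibre N :=
  fun x => WithLp.toLp 2 fun j => moyalProd θ f (fun y => Ψ y j) x

/-! Left Moyal multiplication by a Schwartz function is bounded for the `L²` norm. -/

theorem inner_symp {N : ℕ} (η ξ : Plane N) :
    inner ℝ η (symp N ξ) = - inner ℝ (symp N η) ξ := by
  rw [real_inner_comm ξ (symp N η)]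
  simp only [symp, Matrix.inner_toEuclideanCLM]
  rw [Matrix.dotProduct_mulVec, dotProduct_comm, ← Matrix.mulVec_transpose,
    Matrix.fromBlocks_transpose, ← dotProduct_neg, ← Matrix.neg_mulVec, Matrix.fromBlocks_neg]
  simp


theorem moyalProd_eq {N : ℕ} (θ : ℝ) (f h : 𝓢(Plane N, ℂ)) (x : Plane N) :
    moyalProd θ f h x = ∫ η : Plane N,
      (𝓕 f) η * (Real.fourierChar (inner ℝ η x) : ℂ) * h (x + (Real.pi * θ) • symp N η) := by
  have hA : ∀ u : Plane N, (∫ t : Plane N, f (x - (θ / 2) • symp N u) * h (x + t) *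
      Complex.exp (-(Complex.I * (inner ℝ u t : ℝ)))) =
      f (x - (θ / 2) • symp N u) * ((Real.fourierChar (inner ℝ ((2 * Real.pi)⁻¹ • u) x) : ℂ) *
        (𝓕 h) ((2 * Real.pi)⁻¹ • u)) := by
    intro u
    simp_rw [mul_assoc]
    rw [integral_const_mul, SchwartzMap.fourier_coe, Real.fourier_eq]
    congr 1
    rw [← integral_const_mul]
    refine Eq.trans ?_ (integral_add_left_eq_self (μ := (volume : Measure (Plane N))) _ x)
    refine integral_congr_ae (Eventually.of_forall fun t => ?_)
    simp only [Circle.smul_def, smul_eq_mul, Real.fourierChar_apply]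
    rw [← mul_assoc, ← Complex.exp_add, mul_comm]
    congr 2
    rw [inner_add_left, inner_smul_right, inner_smul_right, inner_smul_left,
      real_inner_comm x u, real_inner_comm t u]
    have : (Real.pi : ℂ) ≠ 0 := by exact_mod_cast Real.pi_ne_zero
    push_cast
    simp
    field_simp
    ring
  have hB : moyalProd θ f h x = ∫ ξ : Plane N, f (x - (Real.pi * θ) • symp N ξ) *
      ((Real.fourierChar (inner ℝ ξ x) : ℂ) * (𝓕 h) ξ) := by
    unfold moyalProd
    simp_rw [hA]
    have := Measure.integral_comp_inv_smul_of_nonneg (volume : Measure (Plane N))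
      (fun ξ : Plane N => f (x - (Real.pi * θ) • symp N ξ) *
      ((Real.fourierChar (inner ℝ ξ x) : ℂ) * (𝓕 h) ξ)) (R := 2 * Real.pi) (by positivity)
    simp only [map_smul, smul_smul] at this
    have e : Real.pi * θ * (2 * Real.pi)⁻¹ = θ / 2 := by
      have := Real.pi_ne_zero
      field_simp
    simp only [e] at this
    rw [this]
    have hd : Module.finrank ℝ (Plane N) = 2 * N := by
      simp [two_mul]
    rw [hd, Complex.real_smul, ← mul_assoc]
    push_cast
    rw [← mul_pow, inv_mul_cancel₀, one_pow, one_mul]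
    have := Real.pi_ne_zero
    simp
  have hf : ∀ y, f y = ∫ η : Plane N, (Real.fourierChar (inner ℝ η y) : ℂ) * (𝓕 f) η := by
    intro y
    have h1 : 𝓕⁻ (𝓕 f) = f := FourierTransform.fourierInv_fourier_eq f
    conv_lhs => rw [← h1, SchwartzMap.fourierInv_coe, Real.fourierInv_eq]
    rfl
  have hh : ∀ y, h y = ∫ η : Plane N, (Real.fourierChar (inner ℝ η y) : ℂ) * (𝓕 h) η := by
    intro y
    have h1 : 𝓕⁻ (𝓕 h) = h := FourierTransform.fourierInv_fourier_eq h
    conv_lhs => rw [← h1, SchwartzMap.fourierInv_coe, Real.fourierInv_eq]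
    rfl
  rw [hB]
  simp_rw [fun ξ : Plane N => hf (x - (Real.pi * θ) • symp N ξ), ← integral_mul_const]
  rw [integral_integral_swap]
  · refine integral_congr_ae (Eventually.of_forall fun η => ?_)
    simp only
    rw [hh, ← integral_const_mul]
    refine integral_congr_ae (Eventually.of_forall fun ξ => ?_)
    simp only
    have : (Real.fourierChar (inner ℝ η (x - (Real.pi * θ) • symp N ξ)) : ℂ) *
        (Real.fourierChar (inner ℝ ξ x) : ℂ) =
        (Real.fourierChar (inner ℝ η x) : ℂ) *
        (Real.fourierChar (inner ℝ ξ (x + (Real.pi * θ) • symp N η)) : ℂ) := by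
      rw [← Circle.coe_mul, ← Circle.coe_mul, ← AddChar.map_add_eq_mul, ← AddChar.map_add_eq_mul]
      congr 2
      rw [inner_sub_right, inner_add_right, inner_smul_right, inner_smul_right, inner_symp η ξ,
        real_inner_comm ξ (symp N η)]
      ring
    linear_combination ((𝓕 f) η * (𝓕 h) ξ) * this
  · have hi : Integrable (fun p : Plane N × Plane N => (𝓕 h) p.1 * (𝓕 f) p.2)
        ((volume : Measure (Plane N)).prod volume) :=
      (𝓕 h).integrable.mul_prod (𝓕 f).integrable
    refine hi.norm.mono' ?_ (Eventually.of_forall fun p => ?_)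
    · apply Continuous.aestronglyMeasurable
      have c1 := (𝓕 h).continuous
      have c2 := (𝓕 f).continuous
      have c3 := Real.continuous_fourierChar
      unfold Function.uncurry
      fun_prop
    · simp only [Function.uncurry, norm_mul, Circle.norm_coe]
      exact le_of_eq (by ring)

theorem lintegral_mul_sq_le {α : Type*} [MeasurableSpace α] (μ : Measure α) {a b : α → ℝ≥0∞}
    (ha : Measurable a) (hb : Measurable b) :
    (∫⁻ x, a x * b x ∂μ) ^ 2 ≤ (∫⁻ x, a x ∂μ) * ∫⁻ x, a x * b x ^ 2 ∂μ := by
  have h2 : ∀ y : ℝ≥0∞, (y ^ (1 / 2 : ℝ)) ^ 2 = y := by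
    intro y
    rw [← ENNReal.rpow_natCast, ← ENNReal.rpow_mul]
    norm_num
  have key := ENNReal.lintegral_mul_le_Lp_mul_Lq μ Real.HolderConjugate.two_two
    (f := fun x => a x ^ (1 / 2 : ℝ)) (g := fun x => a x ^ (1 / 2 : ℝ) * b x)
    (ha.pow_const _).aemeasurable ((ha.pow_const _).mul hb).aemeasurable
  have e1 : ∀ x, ((fun x => a x ^ (1 / 2 : ℝ)) * fun x => a x ^ (1 / 2 : ℝ) * b x) x =
      a x * b x := by
    intro x
    simp only [Pi.mul_apply]
    rw [← mul_assoc, ← sq, h2]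
  have e2 : ∀ y : ℝ≥0∞, y ^ (2 : ℝ) = y ^ 2 := fun y => by
    rw [← ENNReal.rpow_natCast]; norm_num
  simp only [e1, e2, mul_pow, h2] at key
  calc _ ≤ _ := pow_le_pow_left₀ zero_le key 2
    _ = _ := by rw [mul_pow, h2, h2]

theorem starSpinor_eq {N : ℕ} (θ : ℝ) (f : 𝓢(Plane N, ℂ)) (Ψ : 𝓢(Plane N, Fibre N)) :
    (∀ x, Integrable fun η : Plane N =>
      ((𝓕 f) η * (Real.fourierChar (inner ℝ η x) : ℂ)) • Ψ (x + (Real.pi * θ) • symp N η)) ∧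
    starSpinor θ f Ψ = fun x => ∫ η : Plane N,
      ((𝓕 f) η * (Real.fourierChar (inner ℝ η x) : ℂ)) • Ψ (x + (Real.pi * θ) • symp N η) := by
  set G : Plane N → Plane N → Fibre N := fun x η =>
    ((𝓕 f) η * (Real.fourierChar (inner ℝ η x) : ℂ)) • Ψ (x + (Real.pi * θ) • symp N η) with hG
  have c1 := Ψ.continuous
  have c2 := (𝓕 f).continuous
  have c3 := Real.continuous_fourierChar
  have hGc : Continuous (Function.uncurry G) := by
    simp only [hG]; unfold Function.uncurry; fun_prop
  have hGi : ∀ x, Integrable (G x) := by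
    intro x
    obtain ⟨C, hC⟩ := Ψ.toBoundedContinuousFunction.isBounded_range.exists_norm_le
    refine ((𝓕 f).integrable.norm.mul_const C).mono' ?_ (Eventually.of_forall fun η => ?_)
    · exact (hGc.comp (Continuous.prodMk_right x)).aestronglyMeasurable
    · simp only [hG, norm_smul, norm_mul, Circle.norm_coe, mul_one]
      gcongr
      exact hC _ ⟨_, rfl⟩
  refine ⟨hGi, ?_⟩
  funext x
  ext j
  let Ψj : 𝓢(Plane N, ℂ) :=
    SchwartzMap.postcompCLM (𝕜 := ℂ) (EuclideanSpace.proj j : Fibre N →L[ℂ] ℂ) Ψ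
  have h1 := moyalProd_eq θ f Ψj x
  have h2 := (EuclideanSpace.proj j : Fibre N →L[ℂ] ℂ).integral_comp_comm (hGi x)
  change moyalProd θ f Ψj x = (EuclideanSpace.proj j : Fibre N →L[ℂ] ℂ) (∫ η, G x η)
  rw [h1, ← h2]
  rfl

/-- The operator norm bound, with constant the `L¹` norm of the Fourier transform of `f`. -/
theorem starSpinor_bound {N : ℕ} (θ : ℝ) (f : 𝓢(Plane N, ℂ)) (Ψ : 𝓢(Plane N, Fibre N)) :
    AEStronglyMeasurable (starSpinor θ f Ψ) volume ∧
    eLpNorm (starSpinor θ f Ψ) 2 volume ≤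
      (∫⁻ η : Plane N, ‖(𝓕 f) η‖ₑ) * eLpNorm Ψ 2 volume := by
  set G : Plane N → Plane N → Fibre N := fun x η =>
    ((𝓕 f) η * (Real.fourierChar (inner ℝ η x) : ℂ)) • Ψ (x + (Real.pi * θ) • symp N η) with hG
  have c1 := Ψ.continuous
  have c2 := (𝓕 f).continuous
  have c3 := Real.continuous_fourierChar
  have hGc : Continuous (Function.uncurry G) := by
    simp only [hG]; unfold Function.uncurry; fun_prop
  have heq : starSpinor θ f Ψ = fun x => ∫ η, G x η := (starSpinor_eq θ f Ψ).2
  have hm : StronglyMeasurable (fun x => ∫ η, G x η) :=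
    hGc.stronglyMeasurable.integral_prod_right
  rw [heq]
  refine ⟨hm.aestronglyMeasurable, ?_⟩
  set A := ∫⁻ η : Plane N, ‖(𝓕 f) η‖ₑ with hA
  have hsq : ∀ g : Plane N → Fibre N, eLpNorm g 2 volume ^ 2 = ∫⁻ x, ‖g x‖ₑ ^ 2 := by
    intro g
    rw [eLpNorm_eq_lintegral_rpow_enorm_toReal (by norm_num) (by norm_num),
      ← ENNReal.rpow_natCast, ← ENNReal.rpow_mul]
    norm_num
  have hpow : eLpNorm (fun x => ∫ η, G x η) 2 volume ^ 2 ≤ (A * eLpNorm Ψ 2 volume) ^ 2 := by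
    rw [mul_pow, hsq, hsq]
    calc ∫⁻ x, ‖∫ η, G x η‖ₑ ^ 2
        ≤ ∫⁻ x, A * ∫⁻ η, ‖(𝓕 f) η‖ₑ * ‖Ψ (x + (Real.pi * θ) • symp N η)‖ₑ ^ 2 := by
          refine lintegral_mono fun x => ?_
          refine le_trans ?_ (lintegral_mul_sq_le volume c2.enorm.measurable
            (Continuous.measurable (by fun_prop)))
          gcongr
          refine (enorm_integral_le_lintegral_enorm _).trans (le_of_eq ?_)
          refine lintegral_congr fun η => ?_
          have : ‖((Real.fourierChar (inner ℝ η x) : Circle) : ℂ)‖ₑ = 1 := by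
            rw [← ofReal_norm, Circle.norm_coe, ENNReal.ofReal_one]
          simp only [hG, enorm_smul, enorm_mul, this, mul_one]
      _ = A * ∫⁻ η, ∫⁻ x, ‖(𝓕 f) η‖ₑ * ‖Ψ (x + (Real.pi * θ) • symp N η)‖ₑ ^ 2 := by
          have hme : Measurable (Function.uncurry fun x η : Plane N =>
              ‖(𝓕 f) η‖ₑ * ‖Ψ (x + (Real.pi * θ) • symp N η)‖ₑ ^ 2) := by
            refine Measurable.mul (c2.enorm.measurable.comp measurable_snd) ?_
            refine Measurable.pow_const ?_ 2
            exact Continuous.measurable (by fun_prop)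
          rw [lintegral_const_mul _ hme.lintegral_prod_right, lintegral_lintegral_swap]
          exact hme.aemeasurable
      _ = A * ∫⁻ η : Plane N, ‖(𝓕 f) η‖ₑ * ∫⁻ x, ‖Ψ x‖ₑ ^ 2 := by
          congr 1
          refine lintegral_congr fun η => ?_
          rw [lintegral_const_mul _ (Continuous.measurable (by fun_prop)),
            lintegral_add_right_eq_self (fun x => ‖Ψ x‖ₑ ^ 2)]
      _ = A ^ 2 * ∫⁻ x, ‖Ψ x‖ₑ ^ 2 := by
          rw [lintegral_mul_const _ c2.enorm.measurable, ← mul_assoc, sq]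
  by_contra hlt
  push Not at hlt
  exact absurd hpow (not_le.mpr (ENNReal.pow_lt_pow_left two_ne_zero hlt))

theorem starSpinor_memLp {N : ℕ} (θ : ℝ) (f : 𝓢(Plane N, ℂ)) (Ψ : 𝓢(Plane N, Fibre N)) :
    MemLp (starSpinor θ f Ψ) 2 volume := by
  refine ⟨(starSpinor_bound θ f Ψ).1, (starSpinor_bound θ f Ψ).2.trans_lt ?_⟩
  exact ENNReal.mul_lt_top (𝓕 f).integrable.2 (Ψ.memLp 2 volume).2

/-- Componentwise left Moyal multiplication by `f`, as a linear map from Schwartz spinors to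
square-integrable spinors. -/
def starSchwartz {N : ℕ} (θ : ℝ) (f : 𝓢(Plane N, ℂ)) : 𝓢(Plane N, Fibre N) →ₗ[ℂ] Spinors N where
  toFun Ψ := (starSpinor_memLp θ f Ψ).toLp (starSpinor θ f Ψ)
  map_add' Ψ Φ := by
    rw [← MemLp.toLp_add]
    refine MemLp.toLp_congr _ _ (Eventually.of_forall fun x => ?_)
    simp only [Pi.add_apply, (starSpinor_eq θ f _).2]
    rw [← integral_add ((starSpinor_eq θ f Ψ).1 x) ((starSpinor_eq θ f Φ).1 x)]
    simp
  map_smul' c Ψ := by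
    rw [RingHom.id_apply, ← MemLp.toLp_const_smul]
    refine MemLp.toLp_congr _ _ (Eventually.of_forall fun x => ?_)
    simp only [Pi.smul_apply, (starSpinor_eq θ f _).2]
    rw [← integral_smul]
    refine integral_congr_ae (Eventually.of_forall fun η => ?_)
    simp only [smul_apply]
    rw [smul_comm]

/-- The representation `π^θ(f) = L^θ_f ⊗ 1` on square-integrable spinors: the bounded operator
which extends the componentwise left Moyal multiplication `Ψ ↦ f ⋆ Ψ` of Schwartz spinors. -/
def moyalRep {N : ℕ} (θ : ℝ) (f : 𝓢(Plane N, ℂ)) : Spinors N →L[ℂ] Spinors N :=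
  (starSchwartz θ f).extendOfNorm
    (SchwartzMap.toLpCLM ℂ (E := Plane N) (Fibre N) 2 volume).toLinearMap

/-- `π^θ(f)` does extend the Moyal multiplication; by density of the Schwartz spinors this
determines it. -/
theorem moyalRep_toLp {N : ℕ} (θ : ℝ) (f : 𝓢(Plane N, ℂ)) (Ψ : 𝓢(Plane N, Fibre N)) :
    moyalRep θ f (Ψ.toLp 2) =ᵐ[volume] starSpinor θ f Ψ := by
  have hA : (∫⁻ η : Plane N, ‖(𝓕 f) η‖ₑ) ≠ ⊤ := (𝓕 f).integrable.2.ne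
  have h : moyalRep θ f (Ψ.toLp 2) = starSchwartz θ f Ψ := by
    have hd : DenseRange (SchwartzMap.toLpCLM ℂ (E := Plane N) (Fibre N) 2 volume).toLinearMap :=
      SchwartzMap.denseRange_toLpCLM ENNReal.ofNat_ne_top
    refine LinearMap.extendOfNorm_eq hd
      ⟨(∫⁻ η : Plane N, ‖(𝓕 f) η‖ₑ).toReal, fun Φ => ?_⟩ Ψ
    change ‖(starSpinor_memLp θ f Φ).toLp (starSpinor θ f Φ)‖ ≤ _ * ‖Φ.toLp 2 volume‖
    rw [Lp.norm_toLp, SchwartzMap.norm_toLp, ← ENNReal.toReal_mul]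
    exact ENNReal.toReal_mono (ENNReal.mul_ne_top hA (Φ.memLp 2 volume).2.ne)
      (starSpinor_bound θ f Φ).2
  rw [h]
  exact (starSpinor_memLp θ f Ψ).coeFn_toLp

/-! ### The Dirac operator -/

/-- Euclidean Dirac matrices: `2N` hermitian matrices of size `2^N` with
`γ^μ γ^ν + γ^ν γ^μ = 2 δ^{μν}`. In this size such a representation of the Clifford algebra of
`ℝ^{2N}` is automatically irreducible. -/
def IsDirac {N : ℕ} (γ : Fin N ⊕ Fin N → Matrix (Fin (2 ^ N)) (Fin (2 ^ N)) ℂ) : Prop :=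
  (∀ μ, (γ μ).IsHermitian) ∧
    ∀ μ ν, γ μ * γ ν + γ ν * γ μ = if μ = ν then (2 : ℂ) • 1 else 0

/-- The Dirac operator `-i ∑_μ γ^μ ∂_μ` on Schwartz spinors. -/
def diracSchwartz {N : ℕ} (γ : Fin N ⊕ Fin N → Matrix (Fin (2 ^ N)) (Fin (2 ^ N)) ℂ)
    (χ : 𝓢(Plane N, Fibre N)) : 𝓢(Plane N, Fibre N) :=
  (-Complex.I) • ∑ μ : Fin N ⊕ Fin N, SchwartzMap.postcompCLM (𝕜 := ℂ)
    (Matrix.toEuclideanCLM (n := Fin (2 ^ N)) (𝕜 := ℂ) (γ μ))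
    (∂_{EuclideanSpace.single μ (1 : ℝ)} χ : 𝓢(Plane N, Fibre N))

/-- The graph of the Dirac operator on `L²`: pairs `(Ψ, Φ)` of square-integrable spinors with
`-i ∑_μ γ^μ ∂_μ Ψ = Φ` in the sense of distributions, that is, tested against Schwartz spinors. -/
def diracGraph {N : ℕ} (γ : Fin N ⊕ Fin N → Matrix (Fin (2 ^ N)) (Fin (2 ^ N)) ℂ) :
    Submodule ℂ (Spinors N × Spinors N) where
  carrier := {p | ∀ χ : 𝓢(Plane N, Fibre N),
    inner ℂ ((diracSchwartz γ χ).toLp 2 volume) p.1 = inner ℂ (χ.toLp 2 volume) p.2}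
  add_mem' := by
    intro p q hp hq χ
    simp only [Prod.fst_add, Prod.snd_add, inner_add_right, hp χ, hq χ]
  zero_mem' := by
    intro χ
    simp
  smul_mem' := by
    intro c p hp χ
    simp only [Prod.smul_fst, Prod.smul_snd, inner_smul_right, hp χ]

/-- The self-adjoint Dirac operator on `L²` spinors: `-i ∑_μ γ^μ ∂_μ` in the sense of
distributions, with domain all `Ψ` in `L²` whose image is in `L²`. -/
def dirac {N : ℕ} (γ : Fin N ⊕ Fin N → Matrix (Fin (2 ^ N)) (Fin (2 ^ N)) ℂ) :
    Spinors N →ₗ.[ℂ] Spinors N :=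
  (diracGraph γ).toLinearPMap

theorem dirac_graph {N : ℕ} (γ : Fin N ⊕ Fin N → Matrix (Fin (2 ^ N)) (Fin (2 ^ N)) ℂ) :
    (dirac γ).graph = diracGraph γ := by
  refine Submodule.toLinearPMap_graph_eq _ ?_
  rintro ⟨Ψ, Φ⟩ h (rfl : Ψ = 0)
  have hd : DenseRange (SchwartzMap.toLpCLM ℂ (E := Plane N) (Fibre N) 2 volume) :=
    SchwartzMap.denseRange_toLpCLM ENNReal.ofNat_ne_top
  refine hd.eq_zero_of_inner_right (𝕜 := ℂ) fun χ => ?_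
  have := h χ
  simp only [inner_zero_right] at this
  exact this.symm

/-! ### The modulus of an unbounded operator -/

/-- `A` is the modulus `|T| = (T^* T)^{1/2}`: it is self-adjoint and nonnegative and `A² = T^* T`
as unbounded operators, domains included. -/
def IsModulus {E : Type*} [NormedAddCommGroup E] [InnerProductSpace ℂ E] [CompleteSpace E]
    (T A : E →ₗ.[ℂ] E) : Prop :=
  IsSelfAdjoint A ∧ (∀ x : A.domain, 0 ≤ (inner ℂ (x : E) (A x)).re) ∧
    ∀ x z : E, (∃ y, (x, y) ∈ A.graph ∧ (y, z) ∈ A.graph) ↔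
      ∃ y, (x, y) ∈ T.graph ∧ (y, z) ∈ T.adjoint.graph

/-- The bounded operator `R` is `(A + ε)^{-1}`, a two-sided inverse of `A + ε : dom A → E`. -/
def IsShiftInverse {E : Type*} [NormedAddCommGroup E] [InnerProductSpace ℂ E]
    (A : E →ₗ.[ℂ] E) (ε : ℝ) (R : E →L[ℂ] E) : Prop :=
  (∀ x : E, ∃ y : A.domain, (y : E) = R x ∧ A y + (ε : ℂ) • (y : E) = x) ∧
    ∀ y : A.domain, R (A y + (ε : ℂ) • (y : E)) = y

/-! ### Weak Schatten classes -/

/-- The singular values `μ_0(T) ≥ μ_1(T) ≥ …` of a compact operator: the eigenvalues `r` of `|T|`,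
i.e. the `r ≥ 0` such that `r²` is an eigenvalue of `T^* T`, in decreasing order and counted with
multiplicity. The `n`-th one is the largest `s ≥ 0` for which the eigenvalues `r ≥ s` have total
multiplicity greater than `n`, and `0` if there is none. -/
def singularValue {E : Type*} [NormedAddCommGroup E] [InnerProductSpace ℂ E] [CompleteSpace E]
    (T : E →L[ℂ] E) (n : ℕ) : ℝ :=
  sSup {s : ℝ | 0 ≤ s ∧ (n : Cardinal) < Module.rank ℂ
    ↥(⨆ r ∈ Set.Ici s, Module.End.eigenspace
      ((T.adjoint ∘L T : E →L[ℂ] E) : E →ₗ[ℂ] E) ((r ^ 2 : ℝ) : ℂ))}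

/-- The weak Schatten class `L^{p+}`: compact operators with `μ_m(T) = O(m^{-1/p})`. -/
def MemWeakSchatten {E : Type*} [NormedAddCommGroup E] [InnerProductSpace ℂ E] [CompleteSpace E]
    (p : ℝ) (T : E →L[ℂ] E) : Prop :=
  IsCompactOperator T ∧
    (fun m : ℕ => singularValue T m) =O[atTop] fun m : ℕ => (m : ℝ) ^ (-(1 / p))

end Moyal
end

noncomputable section

namespace Moyal

/-! The operator equals `B^* B` with `B = (|D| + ε)^{-1/2} π^θ(f^*)`, because `π^θ(f^*) = π^θ(f)^*`.
Its singular values are controlled through the partial traces `∑ ‖B e_i‖²` over `n` orthonormal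
vectors, so no interpolation between Schatten classes is needed.

Under the Fourier transform `|D|` becomes multiplication by `2π‖ξ‖`. Left Moyal multiplication by
`f` becomes the integral operator with kernel `𝓕 f (ξ - ζ)` times a phase. Each row of this kernel
has the same `L²` norm, that of `𝓕 f`, whatever `θ` is. For orthonormal `e_i` put `s(ξ) = ∑
‖𝓕(π^θ(f^*) e_i)(ξ)‖²`. Bessel's inequality bounds `s` pointwise by a constant independent of `n`
(`sum_norm_sq_fourierL2_moyalRep_le`), and boundedness of `π^θ(f^*)` gives `∫ s = O(n)`.

The partial trace is `∫ s(ξ) / (2π‖ξ‖ + ε) dξ`. Below a momentum `Λ ≥ 1` the pointwise bound on `s`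
gives `O(Λ^{2N-1})`; above it the weight is at most `1/Λ`, which gives `O(n/Λ)`. The choice `Λ = (n
+ 1)^{1/(2N)}` balances the two and yields `μ_n = O(n^{-1/(2N)})`; a fixed large `Λ` yields
compactness (`memWeakSchatten_adjoint_comp_self`). -/

theorem orthonormal_snoc {E : Type*} [NormedAddCommGroup E] [InnerProductSpace ℂ E] {n : ℕ}
    {e : Fin n → E} (he : Orthonormal ℂ e) {x : E} (hx : ‖x‖ = 1)
    (hxe : ∀ i, inner ℂ (e i) x = 0) : Orthonormal ℂ (Fin.snoc e x : Fin (n + 1) → E) := by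
  refine ⟨fun i => ?_, fun i j hij => ?_⟩
  · refine Fin.lastCases ?_ (fun i => ?_) i
    · simpa using hx
    · simpa using he.1 i
  · revert hij
    refine Fin.lastCases ?_ (fun i => ?_) i <;> refine Fin.lastCases ?_ (fun j => ?_) j
    · simp
    · intro _
      simpa using inner_eq_zero_symm.mp (hxe j)
    · intro _
      simpa using hxe i
    · intro hij
      simpa using he.2 (fun h => hij (by rw [h]))

/-! ### Singular values and compactness from partial traces -/

section Hilbert

variable {E : Type*} [NormedAddCommGroup E] [InnerProductSpace ℂ E] [CompleteSpace E]

theorem inner_adjoint_comp_self (B : E →L[ℂ] E) (x : E) :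
    inner ℂ x ((B.adjoint ∘L B) x) = ((‖B x‖ ^ 2 : ℝ) : ℂ) := by
  rw [ContinuousLinearMap.comp_apply, ContinuousLinearMap.adjoint_inner_right,
    inner_self_eq_norm_sq_to_K]
  norm_cast

theorem isSelfAdjoint_adjoint_comp_self (B : E →L[ℂ] E) :
    (B.adjoint ∘L B).adjoint = B.adjoint ∘L B := by
  rw [ContinuousLinearMap.adjoint_comp, ContinuousLinearMap.adjoint_adjoint]

/-- An eigenvector of the square of a positive operator is an eigenvector of the operator. -/
theorem eigenspace_sq_le (B : E →L[ℂ] E) {r : ℝ} (hr : 0 ≤ r) :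
    Module.End.eigenspace
      (((B.adjoint ∘L B).adjoint ∘L (B.adjoint ∘L B) : E →L[ℂ] E) : E →ₗ[ℂ] E)
        ((r ^ 2 : ℝ) : ℂ) ≤
    Module.End.eigenspace ((B.adjoint ∘L B : E →L[ℂ] E) : E →ₗ[ℂ] E) (r : ℂ) := by
  intro x hx
  rw [Module.End.mem_eigenspace_iff] at hx ⊢
  have hpos := inner_adjoint_comp_self B
  have hsa := isSelfAdjoint_adjoint_comp_self B
  set T := B.adjoint ∘L B with hT
  rw [hsa] at hx
  have hx' : T (T x) = ((r ^ 2 : ℝ) : ℂ) • x := hx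
  change T x = (r : ℂ) • x
  -- For `r = 0`, `‖T x‖² = ⟨x, T² x⟩ = 0`. For `r > 0`, the defect `y = T x - r x` satisfies `T y =
  -- -r y`, and positivity of `T` forces `y = 0`.
  rcases hr.eq_or_lt with rfl | hr
  · have h0 : inner ℂ (T x) (T x) = 0 := by
      nth_rewrite 1 [← hsa]
      rw [ContinuousLinearMap.adjoint_inner_left, hx']
      simp
    simpa using h0
  · set y := T x - (r : ℂ) • x with hy
    have hTy : T y = -(r : ℂ) • y := by
      rw [hy, map_sub, map_smul, hx', smul_sub, smul_smul]
      push_cast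
      rw [show -(r : ℂ) * r = -((r : ℂ) ^ 2) by ring]
      module
    have h1 := hpos y
    rw [hTy, inner_smul_right, inner_self_eq_norm_sq_to_K] at h1
    have h2 : -r * ‖y‖ ^ 2 = ‖B y‖ ^ 2 := by
      apply_fun Complex.re at h1
      rw [Complex.ofReal_re] at h1
      rw [← h1, ← Complex.ofReal_re (-r * ‖y‖ ^ 2)]
      push_cast
      rfl
    have h3 : ‖y‖ ^ 2 = 0 := by nlinarith [sq_nonneg ‖y‖, sq_nonneg ‖B y‖]
    have h4 : y = 0 := by simpa using h3
    exact sub_eq_zero.mp h4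

/-- Singular values of `T = B^* B` are defined through eigenspaces of `T^* T = T²`, which lie in
eigenspaces of `T` itself. These are mutually orthogonal, so the quadratic form of `T` is diagonal
on their span, with entries at least `s`. -/
theorem norm_sq_ge_of_mem_iSup_eigenspace (B : E →L[ℂ] E) {s : ℝ} (hs : 0 ≤ s) {x : E}
    (hx : x ∈ ⨆ r ∈ Set.Ici s, Module.End.eigenspace
      (((B.adjoint ∘L B).adjoint ∘L (B.adjoint ∘L B) : E →L[ℂ] E) : E →ₗ[ℂ] E)
        ((r ^ 2 : ℝ) : ℂ)) :
    s * ‖x‖ ^ 2 ≤ ‖B x‖ ^ 2 := by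
  have hpos := inner_adjoint_comp_self B
  have hsa := isSelfAdjoint_adjoint_comp_self B
  have hle : (⨆ r ∈ Set.Ici s, Module.End.eigenspace
      (((B.adjoint ∘L B).adjoint ∘L (B.adjoint ∘L B) : E →L[ℂ] E) : E →ₗ[ℂ] E)
        ((r ^ 2 : ℝ) : ℂ)) ≤ ⨆ r : Set.Ici s, Module.End.eigenspace
      ((B.adjoint ∘L B : E →L[ℂ] E) : E →ₗ[ℂ] E) ((r : ℝ) : ℂ) := by
    rw [iSup_subtype]
    refine iSup₂_mono fun r hr => eigenspace_sq_le B (hs.trans hr)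
  obtain ⟨v, hv, rfl⟩ := (Submodule.mem_iSup_iff_exists_finsupp _ _).mp (hle hx)
  have hsym : ((B.adjoint ∘L B : E →L[ℂ] E) : E →ₗ[ℂ] E).IsSymmetric := by
    intro a b
    change inner ℂ ((B.adjoint ∘L B) a) b = inner ℂ a ((B.adjoint ∘L B) b)
    nth_rewrite 1 [← hsa]
    rw [ContinuousLinearMap.adjoint_inner_left]
  have horth := hsym.orthogonalFamily_eigenspaces.comp
    (f := fun r : Set.Ici s => ((r : ℝ) : ℂ))
    (fun a b h => Subtype.ext (Complex.ofReal_injective h))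
  set T := B.adjoint ∘L B with hT
  have hTv : ∀ r, T (v r) = ((r : ℝ) : ℂ) • v r := fun r =>
    Module.End.mem_eigenspace_iff.mp (hv r)
  have hnorm : ‖v.sum fun _ xi => xi‖ ^ 2 = ∑ r ∈ v.support, ‖v r‖ ^ 2 :=
    horth.norm_sum (fun r => ⟨v r, hv r⟩) v.support
  have hquad : ‖B (v.sum fun _ xi => xi)‖ ^ 2 =
      ∑ r ∈ v.support, (r : ℝ) * ‖v r‖ ^ 2 := by
    have h1 := hpos (v.sum fun _ xi => xi)
    have h2 : T (v.sum fun _ xi => xi) =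
        ∑ r ∈ v.support, ((r : ℝ) : ℂ) • v r := by
      rw [Finsupp.sum, map_sum]
      exact Finset.sum_congr rfl fun r _ => hTv r
    have h3 := horth.inner_sum (fun r => ⟨v r, hv r⟩)
      (fun r => ((r : ℝ) : ℂ) • ⟨v r, hv r⟩) v.support
    rw [h2] at h1
    change inner ℂ (v.sum fun _ xi => xi) (∑ r ∈ v.support, ((r : ℝ) : ℂ) • v r) = _ at h3
    rw [h1] at h3
    simp only [inner_smul_right, inner_self_eq_norm_sq_to_K] at h3
    have h4 : ((‖B (v.sum fun _ xi => xi)‖ ^ 2 : ℝ) : ℂ) =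
        ((∑ r ∈ v.support, (r : ℝ) * ‖v r‖ ^ 2 : ℝ) : ℂ) := by
      rw [h3]
      push_cast
      rfl
    exact_mod_cast h4
  rw [hnorm, hquad, Finset.mul_sum]
  exact Finset.sum_le_sum fun r _ => mul_le_mul_of_nonneg_right r.2 (sq_nonneg _)

/-- If the partial traces of `B^* B` over orthonormal families of `n + 1` vectors are at most
`(n + 1) c`, then the `n`-th singular value of `B^* B` is at most `c`. -/
theorem singularValue_adjoint_comp_self_le (B : E →L[ℂ] E) (n : ℕ) {c : ℝ} (hc : 0 ≤ c)
    (h : ∀ e : Fin (n + 1) → E, Orthonormal ℂ e → ∑ i, ‖B (e i)‖ ^ 2 ≤ (n + 1) * c) :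
    singularValue (B.adjoint ∘L B) n ≤ c := by
  refine Real.sSup_le ?_ hc
  rintro s ⟨hs, hrank⟩
  -- Rank greater than `n` leaves room for `n + 1` independent vectors. After Gram–Schmidt each
  -- contributes at least `s` to the partial trace.
  obtain ⟨w, hw⟩ := exists_linearIndependent_of_le_rank (n := n + 1)
    (by rw [Nat.cast_add_one, ← Cardinal.succ_natCast]; exact Order.succ_le_of_lt hrank)
  have ho := (InnerProductSpace.gramSchmidtNormed_orthonormal hw).comp_linearIsometry
    (Submodule.subtypeₗᵢ _)
  have h1 := h _ ho
  have h2 : ∑ i : Fin (n + 1), s ≤ ∑ i, ‖B ((Submodule.subtypeₗᵢ _ ∘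
      InnerProductSpace.gramSchmidtNormed ℂ w) i)‖ ^ 2 := by
    refine Finset.sum_le_sum fun i _ => ?_
    have := norm_sq_ge_of_mem_iSup_eigenspace B hs
      (InnerProductSpace.gramSchmidtNormed ℂ w i).2
    have hn := ho.1 i
    simp only [Function.comp_apply, Submodule.coe_subtypeₗᵢ, Submodule.subtype_apply] at hn ⊢
    rwa [hn, one_pow, mul_one] at this
  rw [Finset.sum_const, Finset.card_univ, Fintype.card_fin, nsmul_eq_mul] at h2
  have h3 := h2.trans h1
  push_cast at h3
  exact le_of_mul_le_mul_left h3 (by positivity)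

/-- An operator whose square sums over orthonormal families of `n` vectors are `o(n)` is
compact. -/
theorem isCompactOperator_of_sum_norm_sq_le (B : E →L[ℂ] E)
    (h : ∀ δ : ℝ, 0 < δ → ∃ C : ℝ, ∀ (n : ℕ) (e : Fin n → E), Orthonormal ℂ e →
      ∑ i, ‖B (e i)‖ ^ 2 ≤ n * δ + C) : IsCompactOperator B := by
  -- `B` is small off a finite-dimensional space. Otherwise normalised counterexamples could be
  -- appended one at a time, giving orthonormal families of every length `n` with square sum at
  -- least `n δ`, against the bound `n δ / 2 + C`.
  have key : ∀ δ : ℝ, 0 < δ → ∃ (n : ℕ) (e : Fin n → E),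
      ∀ x, (∀ i, inner ℂ (e i) x = 0) → ‖B x‖ ^ 2 ≤ δ * ‖x‖ ^ 2 := by
    intro δ hδ
    by_contra! hcon
    have hbig : ∀ n : ℕ, ∃ e : Fin n → E, Orthonormal ℂ e ∧ ∀ i, δ ≤ ‖B (e i)‖ ^ 2 := by
      intro n
      induction n with
      | zero => exact ⟨Fin.elim0, ⟨fun i => i.elim0, fun i => i.elim0⟩, fun i => i.elim0⟩
      | succ n ih =>
        obtain ⟨e, he, heB⟩ := ih
        obtain ⟨x, hxe, hx⟩ := hcon n e
        have hx0 : x ≠ 0 := by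
          rintro rfl
          simp at hx
        have hnx : 0 < ‖x‖ := norm_pos_iff.mpr hx0
        refine ⟨Fin.snoc e (((‖x‖⁻¹ : ℝ) : ℂ) • x), orthonormal_snoc he ?_ ?_, fun i => ?_⟩
        · rw [norm_smul, Complex.norm_real, norm_inv, norm_norm, inv_mul_cancel₀ hnx.ne']
        · intro i
          rw [inner_smul_right, hxe, mul_zero]
        · refine Fin.lastCases ?_ (fun i => ?_) i
          · rw [Fin.snoc_last, map_smul, norm_smul, Complex.norm_real, norm_inv, norm_norm,
              mul_pow, inv_pow, ← div_eq_inv_mul, le_div_iff₀ (by positivity)]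
            exact hx.le
          · simpa using heB i
    obtain ⟨C, hC⟩ := h (δ / 2) (by positivity)
    obtain ⟨n, hn⟩ := exists_nat_gt (C / (δ / 2))
    rw [div_lt_iff₀ (by positivity)] at hn
    obtain ⟨e, he, heB⟩ := hbig n
    have h1 := hC n e he
    have h2 : ∑ i : Fin n, δ ≤ ∑ i, ‖B (e i)‖ ^ 2 := Finset.sum_le_sum fun i _ => heB i
    rw [Finset.sum_const, Finset.card_univ, Fintype.card_fin, nsmul_eq_mul] at h2
    linarith
  -- Compact operators are norm closed, and `B` composed with the projection onto the span of the `e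
  -- i` is a finite-rank approximation of `B`.
  have hcl := isClosed_setOfPred_isCompactOperator (σ₁₂ := RingHom.id ℂ) (M₁ := E) (M₂ := E)
  change B ∈ {f : E →L[ℂ] E | IsCompactOperator f}
  rw [← hcl.closure_eq, Metric.mem_closure_iff]
  intro η hη
  obtain ⟨n, e, he⟩ := key ((η / 2) ^ 2) (by positivity)
  have : FiniteDimensional ℂ (Submodule.span ℂ (Set.range e)) :=
    FiniteDimensional.span_of_finite ℂ (Set.finite_range e)
  set V := Submodule.span ℂ (Set.range e) with hV
  refine ⟨B ∘L V.starProjection, ?_, ?_⟩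
  · have hc : IsCompactOperator (V.orthogonalProjectionOnto : E →L[ℂ] V) :=
      isCompactOperator_of_locallyCompactSpace_dom _
    exact hc.clm_comp (B ∘L V.subtypeL)
  · rw [dist_eq_norm]
    refine lt_of_le_of_lt (ContinuousLinearMap.opNorm_le_bound _ (half_pos hη).le fun x => ?_)
      (half_lt_self hη)
    have hperp : x - V.starProjection x ∈ Vᗮ := V.sub_starProjection_mem_orthogonal x
    have h1 := he (x - V.starProjection x) fun i =>
      (Submodule.mem_orthogonal _ _).mp hperp _ (Submodule.subset_span ⟨i, rfl⟩)
    rw [← mul_pow] at h1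
    have h2 := (sq_le_sq₀ (norm_nonneg _) (by positivity)).mp h1
    have h3 : ‖x - V.starProjection x‖ ≤ ‖x‖ := by
      rw [← Submodule.starProjection_orthogonal_val]
      exact Submodule.norm_starProjection_apply_le _ x
    calc ‖(B - B ∘L V.starProjection) x‖ = ‖B (x - V.starProjection x)‖ := by simp
      _ ≤ η / 2 * ‖x - V.starProjection x‖ := h2
      _ ≤ η / 2 * ‖x‖ := by gcongr

/-- The bound holds for all `Λ` at once, so `Λ` may be chosen freely: fixed and large for
compactness, growing with `n` for the decay rate. -/
theorem memWeakSchatten_adjoint_comp_self (B : E →L[ℂ] E) {d : ℕ} (hd : 1 ≤ d) {K : ℝ}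
    (hK : 0 ≤ K)
    (h : ∀ Λ : ℝ, 1 ≤ Λ → ∀ (n : ℕ) (e : Fin n → E), Orthonormal ℂ e →
      ∑ i, ‖B (e i)‖ ^ 2 ≤ K * (n / Λ + Λ ^ (d - 1))) :
    MemWeakSchatten d (B.adjoint ∘L B) := by
  have hd0 : (d : ℝ) ≠ 0 := by positivity
  constructor
  · suffices hB : IsCompactOperator B from hB.clm_comp B.adjoint
    refine isCompactOperator_of_sum_norm_sq_le B fun δ hδ => ?_
    -- With `Λ = max 1 (K / δ)` the term linear in `n` is at most `n δ`.
    refine ⟨K * (max 1 (K / δ)) ^ (d - 1), fun n e he => ?_⟩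
    refine (h _ (le_max_left 1 (K / δ)) n e he).trans ?_
    rw [mul_add]
    refine add_le_add_left ?_ _
    have h1 : K / δ ≤ max 1 (K / δ) := le_max_right _ _
    have h2 : 0 < max 1 (K / δ) := lt_max_of_lt_left one_pos
    rw [div_le_iff₀ hδ] at h1
    rw [mul_div_assoc', div_le_iff₀ h2]
    nlinarith [(Nat.cast_nonneg n : (0 : ℝ) ≤ n)]
  · refine IsBigO.of_bound (2 * K) ?_
    filter_upwards [eventually_ge_atTop 1] with n hn
    have hn0 : (0 : ℝ) < n := by exact_mod_cast hn
    have hsv : 0 ≤ singularValue (B.adjoint ∘L B) n := Real.sSup_nonneg fun s hs => hs.1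
    rw [Real.norm_of_nonneg hsv, Real.norm_of_nonneg (by positivity)]
    -- The two terms balance for families of `n + 1` vectors: `Λ ^ (d - 1) = (n + 1) / Λ`.
    set Λ : ℝ := ((n : ℝ) + 1) ^ (1 / d : ℝ) with hΛ
    have hΛ1 : 1 ≤ Λ := Real.one_le_rpow (by linarith) (by positivity)
    have hΛ0 : 0 < Λ := by positivity
    have hΛd : Λ ^ (d - 1) = (n + 1) / Λ := by
      rw [eq_div_iff hΛ0.ne', ← pow_succ, Nat.sub_add_cancel hd, hΛ, ← Real.rpow_natCast,
        ← Real.rpow_mul (by positivity), one_div_mul_cancel hd0, Real.rpow_one]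
    have h1 : singularValue (B.adjoint ∘L B) n ≤ 2 * K * Λ⁻¹ := by
      refine singularValue_adjoint_comp_self_le B n (by positivity) fun e he => ?_
      refine (h Λ hΛ1 _ e he).trans (le_of_eq ?_)
      rw [hΛd]
      push_cast
      field_simp
      ring
    refine h1.trans ?_
    rw [Real.rpow_neg (by positivity)]
    gcongr
    exact Real.rpow_le_rpow hn0.le (by linarith) (by positivity)

end Hilbert

/-- An operator whose graph is its own adjoint relation is densely defined and self-adjoint. -/
theorem isSelfAdjoint_of_graph_adjoint_eq {E : Type*} [NormedAddCommGroup E]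
    [InnerProductSpace ℂ E] [CompleteSpace E] {T : E →ₗ.[ℂ] E}
    (h : T.graph.adjoint = T.graph) : IsSelfAdjoint T := by
  have hd : Dense (T.domain : Set E) := by
    rw [Submodule.dense_iff_topologicalClosure_eq_top, Submodule.topologicalClosure_eq_top_iff,
      Submodule.eq_bot_iff]
    intro y hy
    -- A vector orthogonal to the domain lies over `0` in the adjoint relation, which is the graph
    -- of a function.
    have h0 : ((0 : E), y) ∈ T.graph := by
      rw [← h, Submodule.mem_adjoint_iff]
      intro a b hab
      rw [inner_zero_right, (Submodule.mem_orthogonal _ _).mp hy a (T.mem_domain_of_mem_graph hab),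
        sub_zero]
    exact T.graph_fst_eq_zero_snd h0 rfl
  rw [LinearPMap.isSelfAdjoint_def]
  refine LinearPMap.eq_of_eq_graph ?_
  rw [LinearPMap.adjoint_graph_eq_graph_adjoint hd, h]

/-! ### Fourier multipliers with operator-valued symbol, bounded and unbounded -/

section Multiplication

variable {V F : Type*} [NormedAddCommGroup V] [InnerProductSpace ℝ V] [FiniteDimensional ℝ V]
  [MeasurableSpace V] [BorelSpace V] [NormedAddCommGroup F] [InnerProductSpace ℂ F]

theorem aestronglyMeasurable_clm_apply {M : V → F →L[ℂ] F} (hM : Continuous M) {u : V → F}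
    (hu : AEStronglyMeasurable u volume) :
    AEStronglyMeasurable (fun ξ => M ξ (u ξ)) volume :=
  (Continuous.clm_apply continuous_fst continuous_snd : Continuous fun p : (F →L[ℂ] F) × F =>
    p.1 p.2).comp_aestronglyMeasurable₂ hM.aestronglyMeasurable hu

theorem locallyIntegrable_clm_apply {M : V → F →L[ℂ] F} (hM : Continuous M) {u : V → F}
    (hu : LocallyIntegrable u volume) : LocallyIntegrable (fun ξ => M ξ (u ξ)) volume := by
  rw [locallyIntegrable_iff] at hu ⊢
  intro K hK
  obtain ⟨C, hC⟩ := (hK.image hM).isBounded.exists_norm_le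
  refine ((hu K hK).norm.const_mul C).mono' ?_ ?_
  · exact (Continuous.clm_apply continuous_fst continuous_snd :
      Continuous fun p : (F →L[ℂ] F) × F => p.1 p.2).comp_aestronglyMeasurable₂
        hM.aestronglyMeasurable (hu K hK).1
  · filter_upwards [ae_restrict_mem hK.measurableSet] with ξ hξ
    exact (M ξ).le_of_opNorm_le (hC _ ⟨ξ, hξ, rfl⟩) _

theorem memLp_clm_apply_schwartz {M : V → F →L[ℂ] F} (hM : Continuous M) {φ : 𝓢(V, F)}
    (hφ : HasCompactSupport φ) : MemLp (fun ξ => M ξ (φ ξ)) 2 volume :=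
  (hM.clm_apply φ.continuous).memLp_of_hasCompactSupport
    (hφ.mono' fun ξ hξ => subset_tsupport _ fun h0 => hξ (by simp [h0]))

variable [CompleteSpace F]

theorem locallyIntegrable_coeFn_Lp {V F : Type*} [NormedAddCommGroup V]
    [InnerProductSpace ℝ V] [FiniteDimensional ℝ V] [MeasurableSpace V] [BorelSpace V]
    [NormedAddCommGroup F] (u : Lp F 2 (volume : Measure V)) :
    LocallyIntegrable u volume :=
  (Lp.memLp u).locallyIntegrable (by norm_num)

/-- A weak identity `v = M u`, tested against compactly supported Schwartz functions, holds
almost everywhere. -/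
theorem ae_eq_clm_apply_of_integral_inner_eq {M : V → F →L[ℂ] F} (hM : Continuous M)
    (hMs : ∀ ξ, (M ξ).adjoint = M ξ) {u v : V → F} (hu : LocallyIntegrable u volume)
    (hv : LocallyIntegrable v volume)
    (h : ∀ φ : 𝓢(V, F), HasCompactSupport φ →
      ∫ ξ, inner ℂ (M ξ (φ ξ)) (u ξ) = ∫ ξ, inner ℂ (φ ξ) (v ξ)) :
    v =ᵐ[volume] fun ξ => M ξ (u ξ) := by
  have hMu := locallyIntegrable_clm_apply hM hu
  have hw : ∀ᵐ ξ, (v - fun ξ => M ξ (u ξ)) ξ = 0 := by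
    refine ae_eq_zero_of_integral_contDiff_smul_eq_zero (hv.sub hMu) fun g hg hgc => ?_
    have h1 := hv.integrable_smul_left_of_hasCompactSupport hg.continuous hgc
    have h2 := hMu.integrable_smul_left_of_hasCompactSupport hg.continuous hgc
    have hsub : ∫ ξ, g ξ • (v - fun ξ => M ξ (u ξ)) ξ =
        (∫ ξ, g ξ • v ξ) - ∫ ξ, g ξ • M ξ (u ξ) := by
      rw [← integral_sub h1 h2]
      simp only [Pi.sub_apply, smul_sub]
    rw [hsub, sub_eq_zero]
    refine ext_inner_left ℂ fun c => ?_
    rw [← integral_inner h1, ← integral_inner h2]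
    -- The weak identity is tested on a scalar bump times a fixed vector `c`; letting `c` vary
    -- recovers the vector-valued integral.
    have hcs : HasCompactSupport fun ξ => g ξ • c := hgc.smul_right
    have hφ := h (hcs.toSchwartzMap (hg.smul contDiff_const)) hcs
    have e : ∀ ξ, (hcs.toSchwartzMap (hg.smul contDiff_const)) ξ = g ξ • c := fun ξ => rfl
    simp only [e] at hφ
    rw [eq_comm]
    have hreal : ∀ (r : ℝ) (a b : F), inner ℂ (r • a) b = inner ℂ a (r • b) := fun r a b => by
      rw [RCLike.real_smul_eq_coe_smul (K := ℂ), RCLike.real_smul_eq_coe_smul (K := ℂ),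
        inner_smul_left, inner_smul_right, RCLike.conj_ofReal]
    simp only [hreal] at hφ
    rw [← hφ]
    refine integral_congr_ae (Eventually.of_forall fun ξ => ?_)
    simp only
    nth_rewrite 2 [← hMs]
    rw [ContinuousLinearMap.adjoint_inner_left, ← hreal]
  filter_upwards [hw] with ξ hξ
  exact sub_eq_zero.mp hξ

/-- The Fourier transform on `L²`. -/
def fourierL2 (x : Lp F 2 (volume : Measure V)) : Lp F 2 (volume : Measure V) := 𝓕 x

theorem fourierL2_add (x y : Lp F 2 (volume : Measure V)) :
    fourierL2 (x + y) = fourierL2 x + fourierL2 y := (Lp.fourierTransformₗᵢ V F).map_add x y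

theorem fourierL2_smul (c : ℂ) (x : Lp F 2 (volume : Measure V)) :
    fourierL2 (c • x) = c • fourierL2 x := (Lp.fourierTransformₗᵢ V F).map_smul c x

theorem fourierL2_zero : fourierL2 (0 : Lp F 2 (volume : Measure V)) = 0 :=
  (Lp.fourierTransformₗᵢ V F).map_zero

theorem norm_fourierL2 (x : Lp F 2 (volume : Measure V)) : ‖fourierL2 x‖ = ‖x‖ :=
  Lp.norm_fourier_eq x

theorem inner_fourierL2 (x y : Lp F 2 (volume : Measure V)) :
    inner ℂ (fourierL2 x) (fourierL2 y) = inner ℂ x y := Lp.inner_fourier_eq x y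

theorem fourierL2_injective :
    Function.Injective (fourierL2 : Lp F 2 (volume : Measure V) → Lp F 2 (volume : Measure V)) :=
  (Lp.fourierTransformₗᵢ V F).injective

theorem fourierL2_surjective :
    Function.Surjective (fourierL2 : Lp F 2 (volume : Measure V) → Lp F 2 (volume : Measure V)) :=
  (Lp.fourierTransformₗᵢ V F).surjective

theorem fourierL2_continuous :
    Continuous (fourierL2 : Lp F 2 (volume : Measure V) → Lp F 2 (volume : Measure V)) :=
  (Lp.fourierTransformₗᵢ V F).continuous

theorem fourierL2_toLp (φ : 𝓢(V, F)) : fourierL2 (φ.toLp 2 volume) = (𝓕 φ).toLp 2 volume :=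
  SchwartzMap.toLp_fourier_eq φ

/-- The graph of the Fourier multiplier with operator-valued symbol `M`. -/
def multGraph (M : V → F →L[ℂ] F) :
    Submodule ℂ (Lp F 2 (volume : Measure V) × Lp F 2 (volume : Measure V)) where
  carrier := {p | ⇑(fourierL2 p.2) =ᵐ[volume] fun ξ => M ξ (fourierL2 p.1 ξ)}
  add_mem' := by
    intro p q hp hq
    simp only [Set.mem_ofPred_eq, Prod.fst_add, Prod.snd_add, fourierL2_add]
      at hp hq ⊢
    filter_upwards [hp, hq, Lp.coeFn_add (fourierL2 p.1) (fourierL2 q.1),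
      Lp.coeFn_add (fourierL2 p.2) (fourierL2 q.2)] with
      ξ h1 h2 h3 h4
    rw [h3, h4, Pi.add_apply, Pi.add_apply, map_add, h1, h2]
  zero_mem' := by
    simp only [Set.mem_ofPred_eq, Prod.fst_zero, Prod.snd_zero, fourierL2_zero]
    filter_upwards [Lp.coeFn_zero F 2 (volume : Measure V)] with ξ h1
    rw [h1]
    simp
  smul_mem' := by
    intro c p hp
    simp only [Set.mem_ofPred_eq, Prod.smul_fst, Prod.smul_snd, fourierL2_smul]
      at hp ⊢
    filter_upwards [hp, Lp.coeFn_smul c (fourierL2 p.1), Lp.coeFn_smul c (fourierL2 p.2)] with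
      ξ h1 h3 h4
    rw [h3, h4, Pi.smul_apply, Pi.smul_apply, map_smul, h1]

theorem mem_multGraph_iff {M : V → F →L[ℂ] F} {x y : Lp F 2 (volume : Measure V)} :
    (x, y) ∈ multGraph M ↔
      ⇑(fourierL2 y) =ᵐ[volume] fun ξ => M ξ (fourierL2 x ξ) := Iff.rfl

theorem multGraph_eq_of_fst_eq {M : V → F →L[ℂ] F} {x y z : Lp F 2 (volume : Measure V)}
    (hy : (x, y) ∈ multGraph M) (hz : (x, z) ∈ multGraph M) : y = z := by
  refine fourierL2_injective (Lp.ext ?_)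
  exact (mem_multGraph_iff.mp hy).trans (mem_multGraph_iff.mp hz).symm

theorem inner_of_mem_multGraph {M : V → F →L[ℂ] F} (hMs : ∀ ξ, (M ξ).adjoint = M ξ)
    {a b x y : Lp F 2 (volume : Measure V)} (hab : (a, b) ∈ multGraph M)
    (hxy : (x, y) ∈ multGraph M) : inner ℂ b x = inner ℂ a y := by
  rw [← inner_fourierL2 b x, ← inner_fourierL2 a y, L2.inner_def, L2.inner_def]
  refine integral_congr_ae ?_
  filter_upwards [mem_multGraph_iff.mp hab, mem_multGraph_iff.mp hxy] with ξ h1 h2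
  rw [h1, h2]
  nth_rewrite 1 [← hMs]
  rw [ContinuousLinearMap.adjoint_inner_left]

/-- Testing on Schwartz `a` suffices: compactly supported `φ` already determine the symbol relation
almost everywhere, and for them `M φ` is in `L²`, so a partner `b` exists. This restricted form
serves both maximality of the adjoint and the distributional definition of the Dirac operator. -/
theorem mem_multGraph_of_inner_eq {M : V → F →L[ℂ] F} (hM : Continuous M)
    (hMs : ∀ ξ, (M ξ).adjoint = M ξ) {x y : Lp F 2 (volume : Measure V)}
    (h : ∀ a b : Lp F 2 (volume : Measure V), ∀ φ : 𝓢(V, F), a = (𝓕⁻ φ).toLp 2 →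
      (a, b) ∈ multGraph M → inner ℂ b x = inner ℂ a y) : (x, y) ∈ multGraph M := by
  refine ae_eq_clm_apply_of_integral_inner_eq hM hMs (locallyIntegrable_coeFn_Lp _)
    (locallyIntegrable_coeFn_Lp _) fun φ hφ => ?_
  have hm := memLp_clm_apply_schwartz hM hφ
  have ha : fourierL2 ((𝓕⁻ φ).toLp 2 volume) = φ.toLp 2 volume := by
    rw [fourierL2_toLp, FourierTransform.fourier_fourierInv_eq]
  obtain ⟨b, hb⟩ := fourierL2_surjective (hm.toLp _)
  have key := h _ b φ rfl ?_
  · rw [← inner_fourierL2, ← inner_fourierL2 _ y, ha, hb, L2.inner_def,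
      L2.inner_def] at key
    refine Eq.trans (integral_congr_ae ?_) (key.trans (integral_congr_ae ?_))
    · filter_upwards [hm.coeFn_toLp] with ξ h1
      rw [h1]
    · filter_upwards [φ.coeFn_toLp 2 volume] with ξ h1
      rw [h1]
  · rw [mem_multGraph_iff, ha, hb]
    filter_upwards [hm.coeFn_toLp, φ.coeFn_toLp 2 volume] with ξ h1 h2
    rw [h1, h2]

theorem multGraph_adjoint {M : V → F →L[ℂ] F} (hM : Continuous M)
    (hMs : ∀ ξ, (M ξ).adjoint = M ξ) : (multGraph M).adjoint = multGraph M := by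
  ext ⟨x, y⟩
  rw [Submodule.mem_adjoint_iff]
  constructor
  · intro h
    exact mem_multGraph_of_inner_eq hM hMs fun a b _ _ hab => sub_eq_zero.mp (h a b hab)
  · intro h a b hab
    exact sub_eq_zero.mpr (inner_of_mem_multGraph hMs hab h)

/-- The unbounded Fourier multiplier with operator-valued symbol `M`, on its maximal domain. -/
def multOp (M : V → F →L[ℂ] F) :
    Lp F 2 (volume : Measure V) →ₗ.[ℂ] Lp F 2 (volume : Measure V) :=
  (multGraph M).toLinearPMap

theorem multOp_graph (M : V → F →L[ℂ] F) : (multOp M).graph = multGraph M := by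
  refine Submodule.toLinearPMap_graph_eq _ ?_
  rintro ⟨x, y⟩ h (rfl : x = 0)
  exact multGraph_eq_of_fst_eq h (multGraph M).zero_mem

theorem mem_multOp_domain {M : V → F →L[ℂ] F} {x y : Lp F 2 (volume : Measure V)}
    (h : (x, y) ∈ multGraph M) : ∃ hx : x ∈ (multOp M).domain, multOp M ⟨x, hx⟩ = y := by
  rw [← multOp_graph, LinearPMap.mem_graph_iff] at h
  obtain ⟨z, rfl, hz⟩ := h
  exact ⟨z.2, hz⟩

theorem multOp_apply_mem {M : V → F →L[ℂ] F} (x : (multOp M).domain) :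
    ((x : Lp F 2 (volume : Measure V)), multOp M x) ∈ multGraph M := by
  rw [← multOp_graph]
  exact (multOp M).mem_graph x

theorem isSelfAdjoint_multOp {M : V → F →L[ℂ] F} (hM : Continuous M)
    (hMs : ∀ ξ, (M ξ).adjoint = M ξ) : IsSelfAdjoint (multOp M) :=
  isSelfAdjoint_of_graph_adjoint_eq (by rw [multOp_graph, multGraph_adjoint hM hMs])

theorem norm_eq_of_sq_eq {S T : F →L[ℂ] F} (hS : S.adjoint = S) (hT : T.adjoint = T)
    (h : ∀ x, S (S x) = T (T x)) (x : F) : ‖S x‖ = ‖T x‖ := by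
  have e : ∀ {S : F →L[ℂ] F}, S.adjoint = S → ((‖S x‖ : ℂ)) ^ 2 = inner ℂ x (S (S x)) := by
    intro S hS
    nth_rewrite 2 [← hS]
    rw [ContinuousLinearMap.adjoint_inner_right, inner_self_eq_norm_sq_to_K]
    rfl
  have h1 : ((‖S x‖ : ℂ)) ^ 2 = ((‖T x‖ : ℂ)) ^ 2 := by rw [e hS, e hT, h]
  have h2 : ‖S x‖ ^ 2 = ‖T x‖ ^ 2 := by exact_mod_cast h1
  exact (sq_eq_sq₀ (norm_nonneg _) (norm_nonneg _)).mp h2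

/-- The domain and the values of the square of a Fourier multiplier depend only on the square of
the symbol. -/
theorem multGraph_sq_le {M₁ M₂ : V → F →L[ℂ] F} (hM₂ : Continuous M₂)
    (hs₁ : ∀ ξ, (M₁ ξ).adjoint = M₁ ξ) (hs₂ : ∀ ξ, (M₂ ξ).adjoint = M₂ ξ)
    (hsq : ∀ ξ x, M₁ ξ (M₁ ξ x) = M₂ ξ (M₂ ξ x)) {x z : Lp F 2 (volume : Measure V)}
    (h : ∃ y, (x, y) ∈ multGraph M₁ ∧ (y, z) ∈ multGraph M₁) :
    ∃ y, (x, y) ∈ multGraph M₂ ∧ (y, z) ∈ multGraph M₂ := by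
  obtain ⟨y, hxy, hyz⟩ := h
  rw [mem_multGraph_iff] at hxy hyz
  -- The intermediate vector changes from `M₁ x` to `M₂ x`; self-adjoint symbols with equal squares
  -- give the two equal pointwise norms, so square-integrability carries over.
  have hm : MemLp (fun ξ => M₂ ξ (fourierL2 x ξ)) 2 volume := by
    refine (Lp.memLp (fourierL2 y)).of_le
      (aestronglyMeasurable_clm_apply hM₂ (Lp.aestronglyMeasurable _)) ?_
    filter_upwards [hxy] with ξ h1
    rw [h1, norm_eq_of_sq_eq (hs₁ ξ) (hs₂ ξ) (hsq ξ)]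
  obtain ⟨b, hb⟩ := fourierL2_surjective (hm.toLp _)
  refine ⟨b, ?_, ?_⟩
  · rw [mem_multGraph_iff, hb]
    exact hm.coeFn_toLp
  · rw [mem_multGraph_iff, hb]
    filter_upwards [hm.coeFn_toLp, hxy, hyz] with ξ h1 h2 h3
    rw [h3, h2, h1, hsq]

/-- Both operators are self-adjoint and their symbols have the same square, so `T^* T = A²` with
equal domains; `m ≥ 0` makes the quadratic form of `A` nonnegative. -/
theorem isModulus_multOp {M : V → F →L[ℂ] F} (hM : Continuous M)
    (hMs : ∀ ξ, (M ξ).adjoint = M ξ) {m : V → ℝ} (hm : Continuous m) (hm0 : ∀ ξ, 0 ≤ m ξ)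
    (hsq : ∀ ξ x, M ξ (M ξ x) = ((m ξ : ℂ) ^ 2) • x) :
    IsModulus (multOp M) (multOp fun ξ => (m ξ : ℂ) • ContinuousLinearMap.id ℂ F) := by
  have hmc : Continuous fun ξ => (m ξ : ℂ) • ContinuousLinearMap.id ℂ F := by fun_prop
  have hms : ∀ ξ, ((m ξ : ℂ) • ContinuousLinearMap.id ℂ F).adjoint =
      (m ξ : ℂ) • ContinuousLinearMap.id ℂ F := by
    intro ξ
    rw [map_smulₛₗ, Complex.conj_ofReal, ContinuousLinearMap.adjoint_id]
  have hsq' : ∀ ξ x, ((m ξ : ℂ) • ContinuousLinearMap.id ℂ F)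
      (((m ξ : ℂ) • ContinuousLinearMap.id ℂ F) x) = M ξ (M ξ x) := by
    intro ξ x
    rw [hsq, sq, mul_smul]
    rfl
  refine ⟨isSelfAdjoint_multOp hmc hms, fun x => ?_, fun x z => ?_⟩
  · have hx := mem_multGraph_iff.mp (multOp_apply_mem x)
    rw [← inner_fourierL2, L2.inner_def]
    have e : ∫ ξ, inner ℂ (fourierL2 (x : Lp F 2 (volume : Measure V)) ξ)
        (fourierL2 (multOp (fun ξ => (m ξ : ℂ) • ContinuousLinearMap.id ℂ F) x) ξ) =
        ∫ ξ, ((m ξ * ‖fourierL2 (x : Lp F 2 (volume : Measure V)) ξ‖ ^ 2 : ℝ) : ℂ) := by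
      refine integral_congr_ae ?_
      filter_upwards [hx] with ξ h1
      rw [h1, smul_apply, ContinuousLinearMap.id_apply, inner_smul_right,
        inner_self_eq_norm_sq_to_K]
      push_cast
      rfl
    rw [e, integral_complex_ofReal, Complex.ofReal_re]
    exact integral_nonneg fun ξ => mul_nonneg (hm0 ξ) (sq_nonneg _)
  · have hsa : (multOp M).adjoint = multOp M := isSelfAdjoint_multOp hM hMs
    rw [hsa]
    simp only [multOp_graph]
    exact ⟨multGraph_sq_le hM hms hMs hsq', multGraph_sq_le hmc hMs hms fun ξ x => (hsq' ξ x).symm⟩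

/-- The bounded Fourier multiplier with scalar symbol `g`. -/
def fourierMul (F : Type*) [NormedAddCommGroup F] [InnerProductSpace ℂ F] [CompleteSpace F]
    {g : V → ℂ} (hg : MemLp g ∞ (volume : Measure V)) :
    Lp F 2 (volume : Measure V) →L[ℂ] Lp F 2 (volume : Measure V) :=
  ((Lp.fourierTransformₗᵢ V F).symm.toContinuousLinearEquiv : Lp F 2 (volume : Measure V) →L[ℂ] _)
    ∘L (ContinuousLinearMap.holderL volume ∞ 2 2 (ContinuousLinearMap.lsmul ℂ ℂ) (hg.toLp g))
    ∘L ((Lp.fourierTransformₗᵢ V F).toContinuousLinearEquiv : Lp F 2 (volume : Measure V) →L[ℂ] _)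

theorem fourier_fourierMul {g : V → ℂ} (hg : MemLp g ∞ (volume : Measure V))
    (x : Lp F 2 (volume : Measure V)) :
    ⇑(fourierL2 (fourierMul F hg x)) =ᵐ[volume]
      fun ξ => g ξ • fourierL2 x ξ := by
  have h1 : fourierL2 (fourierMul F hg x) =
      (ContinuousLinearMap.lsmul ℂ ℂ).holder 2 (hg.toLp g) (fourierL2 x) :=
    (Lp.fourierTransformₗᵢ V F).apply_symm_apply _
  rw [h1]
  filter_upwards [ContinuousLinearMap.coeFn_holder (r := 2) (ContinuousLinearMap.lsmul ℂ ℂ)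
    (hg.toLp g) (fourierL2 x), hg.coeFn_toLp] with ξ h2 h3
  rw [h2, h3]
  rfl

theorem fourierMul_adjoint {g : V → ℝ} (hg : MemLp (fun ξ => (g ξ : ℂ)) ∞ (volume : Measure V)) :
    (fourierMul F hg).adjoint = fourierMul F hg := by
  symm
  rw [ContinuousLinearMap.eq_adjoint_iff]
  intro x y
  rw [← inner_fourierL2, ← inner_fourierL2 x, L2.inner_def, L2.inner_def]
  refine integral_congr_ae ?_
  filter_upwards [fourier_fourierMul hg x, fourier_fourierMul hg y] with ξ h1 h2
  rw [h1, h2, inner_smul_left, inner_smul_right, Complex.conj_ofReal]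

theorem fourierMul_comp {g h k : V → ℂ} (hg : MemLp g ∞ (volume : Measure V))
    (hh : MemLp h ∞ (volume : Measure V)) (hk : MemLp k ∞ (volume : Measure V))
    (e : ∀ ξ, g ξ * h ξ = k ξ) : fourierMul F hg ∘L fourierMul F hh = fourierMul F hk := by
  ext1 x
  refine fourierL2_injective (Lp.ext ?_)
  change ⇑(fourierL2 (fourierMul F hg (fourierMul F hh x))) =ᵐ[volume]
    ⇑(fourierL2 (fourierMul F hk x))
  filter_upwards [fourier_fourierMul hg (fourierMul F hh x), fourier_fourierMul hh x,
    fourier_fourierMul hk x] with ξ h1 h2 h3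
  rw [h1, h2, h3, smul_smul, e]

theorem isShiftInverse_fourierMul {m : V → ℝ} {ε : ℝ} (hmε : ∀ ξ, m ξ + ε ≠ 0)
    (hg : MemLp (fun ξ => (((m ξ + ε)⁻¹ : ℝ) : ℂ)) ∞ (volume : Measure V)) :
    IsShiftInverse (multOp fun ξ => (m ξ : ℂ) • ContinuousLinearMap.id ℂ F) ε
      (fourierMul F hg) := by
  have hne : ∀ ξ, (m ξ : ℂ) + ε ≠ 0 := fun ξ => by exact_mod_cast hmε ξ
  constructor
  · intro x
    have hx : (fourierMul F hg x, x - (ε : ℂ) • fourierMul F hg x) ∈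
        multGraph fun ξ => (m ξ : ℂ) • ContinuousLinearMap.id ℂ F := by
      rw [mem_multGraph_iff, sub_eq_add_neg, ← neg_smul, fourierL2_add,
        fourierL2_smul]
      filter_upwards [fourier_fourierMul hg x,
        Lp.coeFn_add (fourierL2 x) ((-(ε : ℂ)) • fourierL2 (fourierMul F hg x)),
        Lp.coeFn_smul (-(ε : ℂ)) (fourierL2 (fourierMul F hg x))] with ξ h1 h2 h3
      rw [h2, Pi.add_apply, h3, Pi.smul_apply, h1, smul_apply, ContinuousLinearMap.id_apply,
        smul_smul, smul_smul]
      nth_rewrite 1 [← one_smul ℂ (fourierL2 x ξ)]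
      rw [← add_smul]
      congr 1
      push_cast
      field_simp [hne ξ]
      ring
    obtain ⟨hd, hA⟩ := mem_multOp_domain hx
    refine ⟨⟨_, hd⟩, rfl, ?_⟩
    rw [hA, sub_add_cancel]
  · intro y
    refine fourierL2_injective (Lp.ext ?_)
    set z := multOp (fun ξ => (m ξ : ℂ) • ContinuousLinearMap.id ℂ F) y with hz
    change ⇑(fourierL2 (fourierMul F hg (z + (ε : ℂ) • (y : Lp F 2 (volume : Measure V)))))
      =ᵐ[volume] ⇑(fourierL2 (y : Lp F 2 (volume : Measure V)))
    have h0 := mem_multGraph_iff.mp (multOp_apply_mem y)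
    filter_upwards [h0, fourier_fourierMul hg (z + (ε : ℂ) • (y : Lp F 2 (volume : Measure V))),
      Lp.coeFn_add (fourierL2 z) ((ε : ℂ) • fourierL2 (y : Lp F 2 (volume : Measure V))),
      Lp.coeFn_smul (ε : ℂ) (fourierL2 (y : Lp F 2 (volume : Measure V)))] with ξ h1 h2 h3 h4
    rw [h2, fourierL2_add, fourierL2_smul, h3, Pi.add_apply, h4,
      Pi.smul_apply, h1, smul_apply, ContinuousLinearMap.id_apply, ← add_smul, smul_smul]
    push_cast
    rw [inv_mul_cancel₀ (hne ξ), one_smul]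

end Multiplication

/-! ### The Dirac operator as a Fourier multiplier -/

section Dirac

theorem fourier_postcompCLM {V F G : Type*} [NormedAddCommGroup V] [InnerProductSpace ℝ V]
    [FiniteDimensional ℝ V] [MeasurableSpace V] [BorelSpace V] [NormedAddCommGroup F]
    [NormedSpace ℂ F] [CompleteSpace F] [NormedAddCommGroup G] [NormedSpace ℂ G] [CompleteSpace G]
    (L : F →L[ℂ] G) (φ : 𝓢(V, F)) (ξ : V) :
    𝓕 (SchwartzMap.postcompCLM (𝕜 := ℂ) L φ) ξ = L (𝓕 φ ξ) := by
  rw [SchwartzMap.fourier_coe, SchwartzMap.fourier_coe, Real.fourier_eq, Real.fourier_eq,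
    ← L.integral_comp_comm ((Real.fourierIntegral_convergent_iff ξ).mpr φ.integrable)]
  simp only [Circle.smul_def, map_smul]
  rfl

/-- The matrix `2π ∑_μ ξ_μ γ^μ`, the symbol of the Dirac operator. -/
def diracMatrix {N : ℕ} (γ : Fin N ⊕ Fin N → Matrix (Fin (2 ^ N)) (Fin (2 ^ N)) ℂ)
    (ξ : Plane N) : Matrix (Fin (2 ^ N)) (Fin (2 ^ N)) ℂ :=
  ∑ μ, ((2 * Real.pi * ξ μ : ℝ) : ℂ) • γ μ

/-- The symbol of the Dirac operator, acting on the spinor fibre. -/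
def diracSymbol {N : ℕ} (γ : Fin N ⊕ Fin N → Matrix (Fin (2 ^ N)) (Fin (2 ^ N)) ℂ)
    (ξ : Plane N) : Fibre N →L[ℂ] Fibre N :=
  Matrix.toEuclideanCLM (n := Fin (2 ^ N)) (𝕜 := ℂ) (diracMatrix γ ξ)

variable {N : ℕ} {γ : Fin N ⊕ Fin N → Matrix (Fin (2 ^ N)) (Fin (2 ^ N)) ℂ}

theorem diracSymbol_eq_sum (ξ : Plane N) : diracSymbol γ ξ =
    ∑ μ, ((2 * Real.pi * ξ μ : ℝ) : ℂ) •
      Matrix.toEuclideanCLM (n := Fin (2 ^ N)) (𝕜 := ℂ) (γ μ) := by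
  simp only [diracSymbol, diracMatrix, map_sum, map_smul]

theorem continuous_diracSymbol : Continuous (diracSymbol γ) := by
  have : diracSymbol γ = fun ξ => ∑ μ, ((2 * Real.pi * ξ μ : ℝ) : ℂ) •
      Matrix.toEuclideanCLM (n := Fin (2 ^ N)) (𝕜 := ℂ) (γ μ) := funext diracSymbol_eq_sum
  rw [this]
  fun_prop

theorem diracSymbol_adjoint (hγ : IsDirac γ) (ξ : Plane N) :
    (diracSymbol γ ξ).adjoint = diracSymbol γ ξ := by
  rw [← ContinuousLinearMap.star_eq_adjoint, diracSymbol, ← map_star]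
  congr 1
  rw [Matrix.star_eq_conjTranspose, diracMatrix, Matrix.conjTranspose_sum]
  refine Finset.sum_congr rfl fun μ _ => ?_
  rw [Matrix.conjTranspose_smul, (hγ.1 μ).eq]
  simp

theorem diracMatrix_sq (hγ : IsDirac γ) (ξ : Plane N) :
    diracMatrix γ ξ * diracMatrix γ ξ = (((2 * Real.pi * ‖ξ‖ : ℝ) : ℂ) ^ 2) • 1 := by
  have h1 : diracMatrix γ ξ * diracMatrix γ ξ = ∑ μ, ∑ ν,
      (((2 * Real.pi * ξ μ : ℝ) : ℂ) * ((2 * Real.pi * ξ ν : ℝ) : ℂ)) • (γ μ * γ ν) := by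
    simp only [diracMatrix, Finset.sum_mul, Finset.mul_sum, smul_mul_smul_comm]
    rw [Finset.sum_comm]
  have h2 : diracMatrix γ ξ * diracMatrix γ ξ = ∑ μ, ∑ ν,
      (((2 * Real.pi * ξ μ : ℝ) : ℂ) * ((2 * Real.pi * ξ ν : ℝ) : ℂ)) • (γ ν * γ μ) := by
    rw [h1, Finset.sum_comm]
    exact Finset.sum_congr rfl fun μ _ => Finset.sum_congr rfl fun ν _ => by rw [mul_comm]
  -- Adding the double sum to its transpose produces the anticommutators, so the Clifford relations
  -- leave only the diagonal.
  have h3 : (2 : ℂ) • (diracMatrix γ ξ * diracMatrix γ ξ) =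
      (2 : ℂ) • ((((2 * Real.pi * ‖ξ‖ : ℝ) : ℂ) ^ 2) • 1) := by
    rw [two_smul]
    nth_rewrite 1 [h1]
    rw [h2]
    simp only [← Finset.sum_add_distrib, ← smul_add, hγ.2]
    simp only [smul_ite, smul_zero, Finset.sum_ite_eq, Finset.mem_univ, if_true, smul_smul,
      ← Finset.sum_smul]
    congr 1
    have hn : (((2 * Real.pi * ‖ξ‖ : ℝ) : ℂ) ^ 2) =
        ((∑ μ, (2 * Real.pi * ξ μ) * (2 * Real.pi * ξ μ) : ℝ) : ℂ) := by
      rw [← Complex.ofReal_pow, mul_pow, EuclideanSpace.real_norm_sq_eq, Finset.mul_sum]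
      congr 1
      exact Finset.sum_congr rfl fun μ _ => by ring
    rw [hn, ← Finset.sum_mul, mul_comm]
    push_cast
    rfl
  exact smul_right_injective _ (two_ne_zero' ℂ) h3

theorem diracSymbol_sq (hγ : IsDirac γ) (ξ : Plane N) (x : Fibre N) :
    diracSymbol γ ξ (diracSymbol γ ξ x) = (((2 * Real.pi * ‖ξ‖ : ℝ) : ℂ) ^ 2) • x := by
  rw [← mul_apply_eq_comp, diracSymbol, ← map_mul, diracMatrix_sq hγ, map_smul,
    map_one, smul_apply, one_apply_eq_self]

theorem fourier_diracSchwartz (χ : 𝓢(Plane N, Fibre N)) (ξ : Plane N) :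
    𝓕 (diracSchwartz γ χ) ξ = diracSymbol γ ξ (𝓕 χ ξ) := by
  rw [diracSchwartz, FourierTransform.fourier_smul, FourierTransform.fourier_sum,
    smul_apply, sum_apply, diracSymbol_eq_sum,
    sum_apply, Finset.smul_sum]
  refine Finset.sum_congr rfl fun μ _ => ?_
  rw [fourier_postcompCLM, SchwartzMap.fourier_lineDerivOp_eq, smul_apply,
    SchwartzMap.smulLeftCLM_apply_apply (by fun_prop), smul_apply, map_smul, smul_smul,
    EuclideanSpace.inner_single_right, RCLike.real_smul_eq_coe_smul (K := ℂ), map_smul, smul_smul]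
  congr 1
  simp only [Complex.coe_algebraMap, RCLike.conj_to_real, one_mul]
  push_cast
  linear_combination (-2 * Real.pi * (ξ μ : ℂ)) * Complex.I_sq

/-- Schwartz spinors lie in the domain of the multiplier, and pairing against them is enough to
detect membership in its graph. -/
theorem diracGraph_eq_multGraph (hγ : IsDirac γ) :
    diracGraph γ = multGraph (diracSymbol γ) := by
  have hgr : ∀ χ : 𝓢(Plane N, Fibre N), (χ.toLp 2 volume, (diracSchwartz γ χ).toLp 2 volume) ∈
      multGraph (diracSymbol γ) := by
    intro χ
    rw [mem_multGraph_iff, fourierL2_toLp, fourierL2_toLp]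
    filter_upwards [(𝓕 χ).coeFn_toLp 2 volume, (𝓕 (diracSchwartz γ χ)).coeFn_toLp 2 volume] with
      ξ h1 h2
    rw [h1, h2, fourier_diracSchwartz]
  ext ⟨Ψ, Φ⟩
  constructor
  · intro h
    refine mem_multGraph_of_inner_eq continuous_diracSymbol (diracSymbol_adjoint hγ) ?_
    rintro a b φ rfl hb
    rw [multGraph_eq_of_fst_eq hb (hgr _)]
    exact h (𝓕⁻ φ)
  · intro h χ
    exact inner_of_mem_multGraph (diracSymbol_adjoint hγ) (hgr χ) h

theorem isModulus_dirac (hγ : IsDirac γ) :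
    IsModulus (dirac γ) (multOp fun ξ : Plane N =>
      ((2 * Real.pi * ‖ξ‖ : ℝ) : ℂ) • ContinuousLinearMap.id ℂ (Fibre N)) := by
  have h : dirac γ = multOp (diracSymbol γ) := by
    rw [dirac, multOp, diracGraph_eq_multGraph hγ]
  rw [h]
  exact isModulus_multOp continuous_diracSymbol (diracSymbol_adjoint hγ) (by fun_prop)
    (fun ξ => by positivity) (diracSymbol_sq hγ)

end Dirac

/-! ### Moyal multiplication as an integral operator in momentum space -/

section Kernel

theorem integral_inner_const {α F : Type*} [MeasurableSpace α] {μ : Measure α}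
    [NormedAddCommGroup F] [InnerProductSpace ℂ F] [CompleteSpace F] {g : α → F}
    (hg : Integrable g μ) (c : F) : ∫ a, inner ℂ (g a) c ∂μ = inner ℂ (∫ a, g a ∂μ) c := by
  rw [← inner_conj_symm, ← integral_inner hg, ← integral_conj]
  simp only [inner_conj_symm]

variable {N : ℕ}

/-- The integral kernel of left Moyal multiplication by `f` in Fourier space. -/
def moyalKernel (θ : ℝ) (f : 𝓢(Plane N, ℂ)) (ξ ζ : Plane N) : ℂ :=
  (𝓕 f) (ξ - ζ) * (Real.fourierChar (inner ℝ ζ ((Real.pi * θ) • symp N ξ)) : ℂ)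

theorem continuous_moyalKernel (θ : ℝ) (f : 𝓢(Plane N, ℂ)) :
    Continuous fun p : Plane N × Plane N => moyalKernel θ f p.1 p.2 := by
  have c2 := (𝓕 f).continuous
  have c3 := Real.continuous_fourierChar
  unfold moyalKernel
  fun_prop

theorem norm_moyalKernel (θ : ℝ) (f : 𝓢(Plane N, ℂ)) (ξ ζ : Plane N) :
    ‖moyalKernel θ f ξ ζ‖ = ‖(𝓕 f) (ξ - ζ)‖ := by
  rw [moyalKernel, norm_mul, Circle.norm_coe, mul_one]

/-- The phase has modulus one, so the integrand is dominated by that of a convolution of two `L¹`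
functions. -/
theorem integrable_moyalKernel_smul (θ : ℝ) (f : 𝓢(Plane N, ℂ)) (φ : 𝓢(Plane N, Fibre N)) :
    Integrable (fun p : Plane N × Plane N => moyalKernel θ f p.1 p.2 • φ p.2)
      (volume.prod volume) := by
  have h := Integrable.convolution_integrand (ContinuousLinearMap.mul ℝ ℝ)
    (φ.integrable (μ := volume)).norm ((𝓕 f).integrable (μ := volume)).norm
  refine h.mono' ?_ (Eventually.of_forall fun p => ?_)
  · exact ((continuous_moyalKernel θ f).smul
      (φ.continuous.comp continuous_snd)).aestronglyMeasurable
  · rw [norm_smul, norm_moyalKernel, ContinuousLinearMap.mul_apply', mul_comm]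

/-- Left Moyal multiplication by `f`, applied in Fourier space to a Schwartz spinor. -/
def kernelApply (θ : ℝ) (f : 𝓢(Plane N, ℂ)) (φ : 𝓢(Plane N, Fibre N)) (ξ : Plane N) : Fibre N :=
  ∫ ζ, moyalKernel θ f ξ ζ • φ ζ

theorem integrable_kernelApply (θ : ℝ) (f : 𝓢(Plane N, ℂ)) (φ : 𝓢(Plane N, Fibre N)) :
    Integrable (kernelApply θ f φ) volume :=
  (integrable_moyalKernel_smul θ f φ).integral_prod_left

theorem integrable_moyalKernel_smul_right (θ : ℝ) (f : 𝓢(Plane N, ℂ))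
    (φ : 𝓢(Plane N, Fibre N)) (ξ : Plane N) :
    Integrable (fun ζ => moyalKernel θ f ξ ζ • φ ζ) volume := by
  obtain ⟨C, hC⟩ := (𝓕 f).toBoundedContinuousFunction.isBounded_range.exists_norm_le
  refine (φ.integrable.norm.const_mul C).mono' ?_ (Eventually.of_forall fun ζ => ?_)
  · exact (((continuous_moyalKernel θ f).comp (Continuous.prodMk_right ξ)).smul
      φ.continuous).aestronglyMeasurable
  · rw [norm_smul, norm_moyalKernel]
    gcongr
    exact hC _ ⟨_, rfl⟩

theorem inner_symp_self (η : Plane N) : inner ℝ η (symp N η) = 0 := by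
  have h := inner_symp η η
  rw [real_inner_comm η (symp N η)] at h
  linarith [real_inner_comm η (symp N η)]

/-- A Moyal product of Schwartz functions as an inverse Fourier integral. -/
theorem starSpinor_eq_integral_kernelApply (θ : ℝ) (f : 𝓢(Plane N, ℂ))
    (Ψ : 𝓢(Plane N, Fibre N)) (x : Plane N) :
    starSpinor θ f Ψ x = ∫ ξ, (Real.fourierChar (inner ℝ ξ x) : ℂ) • kernelApply θ f (𝓕 Ψ) ξ := by
  set H : Plane N → Plane N → Fibre N := fun η ζ =>
    ((𝓕 f) η * (Real.fourierChar (inner ℝ η x) : ℂ) *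
      (Real.fourierChar (inner ℝ ζ (x + (Real.pi * θ) • symp N η)) : ℂ)) • (𝓕 Ψ) ζ with hH
  have c1 := (𝓕 Ψ).continuous
  have c2 := (𝓕 f).continuous
  have c3 := Real.continuous_fourierChar
  have hΨ : ∀ y, Ψ y = ∫ ζ : Plane N, (Real.fourierChar (inner ℝ ζ y) : ℂ) • (𝓕 Ψ) ζ := by
    intro y
    have h1 : 𝓕⁻ (𝓕 Ψ) = Ψ := FourierTransform.fourierInv_fourier_eq Ψ
    conv_lhs => rw [← h1, SchwartzMap.fourierInv_coe, Real.fourierInv_eq]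
    rfl
  -- Substituting `η = ξ - ζ` makes `ξ` the total momentum. The twist `⟨ζ, S(ξ - ζ)⟩` reduces to
  -- `⟨ζ, S ξ⟩` because `S` is antisymmetric.
  have hshift : ∀ ξ ζ, H (ξ - ζ) ζ =
      (Real.fourierChar (inner ℝ ξ x) : ℂ) • moyalKernel θ f ξ ζ • (𝓕 Ψ) ζ := by
    intro ξ ζ
    simp only [hH, moyalKernel, smul_smul]
    congr 1
    have : (Real.fourierChar (inner ℝ (ξ - ζ) x) : ℂ) *
        (Real.fourierChar (inner ℝ ζ (x + (Real.pi * θ) • symp N (ξ - ζ))) : ℂ) =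
        (Real.fourierChar (inner ℝ ξ x) : ℂ) *
        (Real.fourierChar (inner ℝ ζ ((Real.pi * θ) • symp N ξ)) : ℂ) := by
      rw [← Circle.coe_mul, ← Circle.coe_mul, ← AddChar.map_add_eq_mul, ← AddChar.map_add_eq_mul]
      congr 2
      rw [inner_sub_left, inner_add_right, inner_smul_right, inner_smul_right, map_sub,
        inner_sub_right, inner_symp_self]
      ring
    linear_combination (𝓕 f) (ξ - ζ) * this
  have hcontH : Continuous fun p : Plane N × Plane N => H p.1 p.2 := by
    simp only [hH]
    fun_prop
  calc starSpinor θ f Ψ x = ∫ η, ∫ ζ, H η ζ := by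
        rw [(starSpinor_eq θ f Ψ).2]
        refine integral_congr_ae (Eventually.of_forall fun η => ?_)
        simp only [hH]
        rw [hΨ, ← integral_smul]
        simp only [smul_smul]
    _ = ∫ ζ, ∫ η, H η ζ := by
        refine integral_integral_swap ?_
        refine (((𝓕 f).integrable (μ := volume)).norm.mul_prod
          ((𝓕 Ψ).integrable (μ := volume)).norm).mono' hcontH.aestronglyMeasurable
          (Eventually.of_forall fun p => ?_)
        simp only [Function.uncurry, hH, norm_smul, norm_mul, Circle.norm_coe, mul_one, le_refl]
    _ = ∫ ζ, ∫ ξ, H (ξ - ζ) ζ := by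
        refine integral_congr_ae (Eventually.of_forall fun ζ => ?_)
        exact (integral_sub_right_eq_self (fun η => H η ζ) ζ).symm
    _ = ∫ ξ, ∫ ζ, H (ξ - ζ) ζ := by
        refine (integral_integral_swap ?_).symm
        refine (integrable_moyalKernel_smul θ f (𝓕 Ψ)).norm.mono' ?_
          (Eventually.of_forall fun p => ?_)
        · exact (hcontH.comp (g := fun p : Plane N × Plane N => H p.1 p.2)
            (f := fun p : Plane N × Plane N => (p.1 - p.2, p.2))
            (by fun_prop)).aestronglyMeasurable
        · simp only [Function.uncurry, hshift]
          rw [norm_smul, Circle.norm_coe, one_mul]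
    _ = _ := by
        refine integral_congr_ae (Eventually.of_forall fun ξ => ?_)
        simp only [hshift, kernelApply]
        rw [integral_smul]

/-- This is Parseval's identity by Fubini. It uses only that the momentum-space side is in `L¹`, as
its square-integrability is not yet known. -/
theorem integral_inner_starSpinor (θ : ℝ) (f : 𝓢(Plane N, ℂ)) (χ Ψ : 𝓢(Plane N, Fibre N)) :
    ∫ x, inner ℂ (χ x) (starSpinor θ f Ψ x) =
      ∫ ξ, inner ℂ ((𝓕 χ) ξ) (kernelApply θ f (𝓕 Ψ) ξ) := by
  have hu := integrable_kernelApply θ f (𝓕 Ψ)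
  simp only [starSpinor_eq_integral_kernelApply]
  generalize kernelApply θ f (𝓕 Ψ) = u at hu ⊢
  have c3 := Real.continuous_fourierChar
  have hc : ∀ x : Plane N,
      Continuous fun ξ : Plane N => (Real.fourierChar (inner ℝ ξ x) : ℂ) := fun x => by fun_prop
  have hc2 : Continuous fun p : Plane N × Plane N =>
      (Real.fourierChar (inner ℝ p.2 p.1) : ℂ) := by fun_prop
  have hu2 : AEStronglyMeasurable (fun p : Plane N × Plane N => u p.2) (volume.prod volume) :=
    hu.1.comp_snd
  have hui : ∀ x : Plane N,
      Integrable fun ξ => (Real.fourierChar (inner ℝ ξ x) : ℂ) • u ξ := by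
    intro x
    refine hu.norm.mono' ((hc x).aestronglyMeasurable.smul hu.1) (Eventually.of_forall fun ξ => ?_)
    rw [norm_smul, Circle.norm_coe, one_mul]
  calc ∫ x, inner ℂ (χ x) (∫ ξ, (Real.fourierChar (inner ℝ ξ x) : ℂ) • u ξ)
      = ∫ x, ∫ ξ, inner ℂ (χ x) ((Real.fourierChar (inner ℝ ξ x) : ℂ) • u ξ) := by
        refine integral_congr_ae (Eventually.of_forall fun x => ?_)
        simp only
        rw [integral_inner (hui x)]
    _ = ∫ ξ, ∫ x, inner ℂ (χ x) ((Real.fourierChar (inner ℝ ξ x) : ℂ) • u ξ) := by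
        refine integral_integral_swap ?_
        refine ((χ.integrable (μ := volume)).norm.mul_prod hu.norm).mono' ?_
          (Eventually.of_forall fun p => ?_)
        · exact (χ.continuous.comp continuous_fst).aestronglyMeasurable.inner
            (hc2.aestronglyMeasurable.smul hu2)
        · refine (norm_inner_le_norm _ _).trans (le_of_eq ?_)
          rw [norm_smul, Circle.norm_coe, one_mul]
    _ = _ := by
        refine integral_congr_ae (Eventually.of_forall fun ξ => ?_)
        simp only
        rw [SchwartzMap.fourier_coe, Real.fourier_eq, ← integral_inner_const
          ((Real.fourierIntegral_convergent_iff ξ).mpr χ.integrable)]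
        refine integral_congr_ae (Eventually.of_forall fun x => ?_)
        simp only [Circle.smul_def]
        rw [inner_smul_left, inner_smul_right, AddChar.map_neg_eq_inv, Circle.coe_inv_eq_conj,
          RCLike.conj_conj, real_inner_comm]

/-- The two sides have equal pairings with all compactly supported Schwartz spinors; the
weak-identity criterion applies with the identity symbol. -/
theorem fourierL2_moyalRep_toLp (θ : ℝ) (f : 𝓢(Plane N, ℂ)) (Ψ : 𝓢(Plane N, Fibre N)) :
    ⇑(fourierL2 (moyalRep θ f (Ψ.toLp 2 volume))) =ᵐ[volume] kernelApply θ f (𝓕 Ψ) := by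
  have h := ae_eq_clm_apply_of_integral_inner_eq (V := Plane N) (F := Fibre N)
    (M := fun _ => ContinuousLinearMap.id ℂ (Fibre N)) continuous_const
    (fun _ => ContinuousLinearMap.adjoint_id)
    (integrable_kernelApply θ f (𝓕 Ψ)).locallyIntegrable
    (locallyIntegrable_coeFn_Lp (fourierL2 (moyalRep θ f (Ψ.toLp 2 volume)))) fun φ _ => ?_
  · exact h
  · have h1 := integral_inner_starSpinor θ f (𝓕⁻ φ) Ψ
    rw [FourierTransform.fourier_fourierInv_eq] at h1
    refine h1.symm.trans ?_
    have h2 := inner_fourierL2 ((𝓕⁻ φ).toLp 2 volume) (moyalRep θ f (Ψ.toLp 2 volume))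
    rw [fourierL2_toLp, FourierTransform.fourier_fourierInv_eq, L2.inner_def, L2.inner_def] at h2
    refine Eq.trans (integral_congr_ae ?_) (h2.symm.trans (integral_congr_ae ?_))
    · filter_upwards [moyalRep_toLp θ f Ψ, (𝓕⁻ φ).coeFn_toLp 2 volume] with x h3 h4
      rw [h3, h4]
    · filter_upwards [φ.coeFn_toLp 2 volume] with x h3
      rw [h3]

theorem fourier_conj (f : 𝓢(Plane N, ℂ)) (η : Plane N) :
    (𝓕 (conj f)) η = (starRingEnd ℂ) ((𝓕 f) (-η)) := by
  rw [SchwartzMap.fourier_coe, SchwartzMap.fourier_coe, Real.fourier_eq, Real.fourier_eq,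
    ← integral_conj]
  refine integral_congr_ae (Eventually.of_forall fun x => ?_)
  simp only [Circle.smul_def, smul_eq_mul, map_mul, inner_neg_right, neg_neg,
    AddChar.map_neg_eq_inv, Circle.coe_inv_eq_conj]
  rfl

theorem conj_moyalKernel_conj (θ : ℝ) (f : 𝓢(Plane N, ℂ)) (ξ ζ : Plane N) :
    (starRingEnd ℂ) (moyalKernel θ (conj f) ξ ζ) = moyalKernel θ f ζ ξ := by
  rw [moyalKernel, moyalKernel, map_mul, fourier_conj, RCLike.conj_conj, neg_sub,
    ← Circle.coe_inv_eq_conj, ← AddChar.map_neg_eq_inv]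
  congr 3
  rw [inner_smul_right, inner_smul_right, inner_symp ζ ξ, real_inner_comm]
  ring_nf

/-- The kernels of `f^*` and `f` are conjugate transposes: conjugation reflects `𝓕 f`, and
antisymmetry of `S` inverts the phase. Fubini on Schwartz spinors and density do the rest. -/
theorem moyalRep_conj (θ : ℝ) (f : 𝓢(Plane N, ℂ)) :
    moyalRep θ (conj f) = (moyalRep θ f).adjoint := by
  rw [ContinuousLinearMap.eq_adjoint_iff]
  intro x y
  have hd : DenseRange (SchwartzMap.toLpCLM ℂ (E := Plane N) (Fibre N) 2 volume) :=
    SchwartzMap.denseRange_toLpCLM ENNReal.ofNat_ne_top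
  refine hd.induction_on₂ (isClosed_eq (by fun_prop) (by fun_prop)) (fun φ ψ => ?_) x y
  rw [SchwartzMap.toLpCLM_apply, SchwartzMap.toLpCLM_apply, ← inner_fourierL2,
    ← inner_fourierL2 (φ.toLp 2 volume), L2.inner_def, L2.inner_def, fourierL2_toLp,
    fourierL2_toLp]
  set K : Plane N → Plane N → ℂ := fun ξ ζ =>
    moyalKernel θ f ζ ξ * inner ℂ ((𝓕 φ) ζ) ((𝓕 ψ) ξ) with hK
  calc _ = ∫ ξ, ∫ ζ, K ξ ζ := by
        refine integral_congr_ae ?_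
        filter_upwards [fourierL2_moyalRep_toLp θ (conj f) φ, (𝓕 ψ).coeFn_toLp 2 volume] with
          ξ h1 h2
        rw [h1, h2, kernelApply, ← integral_inner_const
          (integrable_moyalKernel_smul_right θ (conj f) (𝓕 φ) ξ)]
        simp only [inner_smul_left, conj_moyalKernel_conj, hK]
    _ = ∫ ζ, ∫ ξ, K ξ ζ := by
        refine integral_integral_swap ?_
        obtain ⟨C, hC⟩ := (𝓕 f).toBoundedContinuousFunction.isBounded_range.exists_norm_le
        refine ((((𝓕 ψ).integrable (μ := volume)).norm.mul_prod
          ((𝓕 φ).integrable (μ := volume)).norm).const_mul C).mono' ?_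
          (Eventually.of_forall fun p => ?_)
        · have c0 := (continuous_moyalKernel θ f).comp continuous_swap
          have c1 := (𝓕 φ).continuous
          have c2 := (𝓕 ψ).continuous
          refine Continuous.aestronglyMeasurable (Continuous.mul c0 ?_)
          fun_prop
        · simp only [Function.uncurry, hK, norm_mul, norm_moyalKernel]
          have h3 : ‖(𝓕 f) (p.2 - p.1)‖ ≤ C := hC _ ⟨_, rfl⟩
          refine mul_le_mul h3 ?_ (norm_nonneg _) ((norm_nonneg _).trans h3)
          rw [mul_comm]
          exact norm_inner_le_norm _ _
    _ = _ := by
        refine integral_congr_ae ?_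
        filter_upwards [fourierL2_moyalRep_toLp θ f ψ, (𝓕 φ).coeFn_toLp 2 volume] with ζ h1 h2
        rw [h1, h2, kernelApply, ← integral_inner
          (integrable_moyalKernel_smul_right θ f (𝓕 ψ) ζ)]
        simp only [inner_smul_right, hK]

/-- A row of the kernel is, up to phases, a reflected translate of `𝓕 f`, so its norm does not
depend on `ξ`. The conjugate compensates for the inner product being antilinear in its first slot.
-/
theorem memLp_kernelVec (θ : ℝ) (f : 𝓢(Plane N, ℂ)) (ξ : Plane N) (c : Fibre N) :
    MemLp (fun ζ => (starRingEnd ℂ) (moyalKernel θ f ξ ζ) • c) 2 volume ∧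
    eLpNorm (fun ζ => (starRingEnd ℂ) (moyalKernel θ f ξ ζ) • c) 2 volume =
      ‖c‖ₑ * eLpNorm (fun ζ => (𝓕 f) ζ) 2 volume := by
  have hmp := Measure.measurePreserving_sub_left (volume : Measure (Plane N)) ξ
  have hcont : Continuous fun ζ => (starRingEnd ℂ) (moyalKernel θ f ξ ζ) • c :=
    (Complex.continuous_conj.comp ((continuous_moyalKernel θ f).comp
      (Continuous.prodMk_right ξ))).smul continuous_const
  have hnorm : eLpNorm (fun ζ => (starRingEnd ℂ) (moyalKernel θ f ξ ζ) • c) 2 volume =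
      ‖c‖ₑ * eLpNorm (fun ζ => (𝓕 f) ζ) 2 volume := by
    have h1 := eLpNorm_comp_measurePreserving (p := 2) (g := fun ζ => (𝓕 f) ζ)
      (𝓕 f).continuous.aestronglyMeasurable hmp
    calc _ = eLpNorm (‖c‖ • fun ζ => ‖(𝓕 f) (ξ - ζ)‖) 2 volume := by
          refine eLpNorm_congr_norm_ae (Eventually.of_forall fun ζ => ?_)
          rw [norm_smul, RCLike.norm_conj, norm_moyalKernel, Pi.smul_apply, smul_eq_mul, norm_mul,
            norm_norm, norm_norm, mul_comm]
      _ = _ := by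
          rw [eLpNorm_const_smul, enorm_norm, eLpNorm_norm, ← h1]
          rfl
  refine ⟨⟨hcont.aestronglyMeasurable, ?_⟩, hnorm⟩
  rw [hnorm]
  exact ENNReal.mul_lt_top enorm_lt_top ((𝓕 f).memLp 2 volume).2

/-- The vector whose inner product with `v` is the component along `c`, at the momentum `ξ`, of
the Moyal kernel applied to `v`. -/
def kernelVec (θ : ℝ) (f : 𝓢(Plane N, ℂ)) (ξ : Plane N) (c : Fibre N) : Spinors N :=
  (memLp_kernelVec θ f ξ c).1.toLp _

theorem norm_kernelVec (θ : ℝ) (f : 𝓢(Plane N, ℂ)) (ξ : Plane N) (c : Fibre N) :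
    ‖kernelVec θ f ξ c‖ = ‖c‖ * ‖(𝓕 f).toLp 2 volume‖ := by
  rw [kernelVec, Lp.norm_toLp, (memLp_kernelVec θ f ξ c).2, ENNReal.toReal_mul,
    SchwartzMap.norm_toLp, toReal_enorm]

theorem inner_kernelVec_toLp (θ : ℝ) (f : 𝓢(Plane N, ℂ)) (ξ : Plane N) (c : Fibre N)
    (φ : 𝓢(Plane N, Fibre N)) :
    inner ℂ (kernelVec θ f ξ c) (φ.toLp 2 volume) = inner ℂ c (kernelApply θ f φ ξ) := by
  rw [kernelApply, ← integral_inner (integrable_moyalKernel_smul_right θ f φ ξ), L2.inner_def]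
  refine integral_congr_ae ?_
  filter_upwards [(memLp_kernelVec θ f ξ c).1.coeFn_toLp, φ.coeFn_toLp 2 volume] with ζ h1 h2
  rw [kernelVec, h1, h2, inner_smul_left, inner_smul_right, RCLike.conj_conj]

/-- The kernel formula passes from Schwartz spinors to all of `L²`: the right side is continuous in
`x` for every `ξ`, while the left converges almost everywhere along a subsequence. -/
theorem inner_fourierL2_moyalRep (θ : ℝ) (f : 𝓢(Plane N, ℂ)) (c : Fibre N) (x : Spinors N) :
    ∀ᵐ ξ, inner ℂ c (fourierL2 (moyalRep θ f x) ξ) =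
      inner ℂ (kernelVec θ f ξ c) (fourierL2 x) := by
  have hd : DenseRange (SchwartzMap.toLpCLM ℂ (E := Plane N) (Fibre N) 2 volume) :=
    SchwartzMap.denseRange_toLpCLM ENNReal.ofNat_ne_top
  obtain ⟨w, hw, hlim⟩ := mem_closure_iff_seq_limit.mp (hd x)
  choose φ hφ using hw
  have hlim2 : Tendsto (fun n => fourierL2 (moyalRep θ f (w n))) atTop
      (nhds (fourierL2 (moyalRep θ f x))) :=
    ((fourierL2_continuous.comp (moyalRep θ f).continuous).tendsto x).comp hlim
  obtain ⟨ns, hns, hae⟩ := (tendstoInMeasure_of_tendsto_Lp hlim2).exists_seq_tendsto_ae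
  have hall : ∀ᵐ ξ, ∀ n, fourierL2 (moyalRep θ f (w n)) ξ = kernelApply θ f (𝓕 (φ n)) ξ := by
    rw [ae_all_iff]
    intro n
    rw [← hφ n]
    exact fourierL2_moyalRep_toLp θ f (φ n)
  filter_upwards [hae, hall] with ξ h1 h2
  refine tendsto_nhds_unique (tendsto_const_nhds.inner h1) ?_
  have h3 : Tendsto (fun n => inner ℂ (kernelVec θ f ξ c) (fourierL2 (w (ns n)))) atTop
      (nhds (inner ℂ (kernelVec θ f ξ c) (fourierL2 x))) :=
    tendsto_const_nhds.inner ((fourierL2_continuous.tendsto x).comp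
      (hlim.comp hns.tendsto_atTop))
  refine h3.congr fun n => ?_
  rw [h2, ← hφ, SchwartzMap.toLpCLM_apply, fourierL2_toLp, inner_kernelVec_toLp]

/-- The Hilbert–Schmidt bound for Moyal multiplication, pointwise in momentum space. -/
theorem sum_norm_sq_fourierL2_moyalRep_le (θ : ℝ) (f : 𝓢(Plane N, ℂ)) {n : ℕ}
    {e : Fin n → Spinors N} (he : Orthonormal ℂ e) :
    ∀ᵐ ξ, ∑ i, ‖fourierL2 (moyalRep θ f (e i)) ξ‖ ^ 2 ≤
      2 ^ N * ‖(𝓕 f).toLp 2 volume‖ ^ 2 := by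
  have hF : Orthonormal ℂ fun i => fourierL2 (e i) :=
    he.comp_linearIsometry (Lp.fourierTransformₗᵢ (Plane N) (Fibre N)).toLinearIsometry
  have hall : ∀ᵐ ξ, ∀ i j, inner ℂ (EuclideanSpace.single j (1 : ℂ))
      (fourierL2 (moyalRep θ f (e i)) ξ) =
      inner ℂ (kernelVec θ f ξ (EuclideanSpace.single j 1)) (fourierL2 (e i)) := by
    rw [ae_all_iff]
    intro i
    rw [ae_all_iff]
    exact fun j => inner_fourierL2_moyalRep θ f _ _
  filter_upwards [hall] with ξ h
  -- At fixed `ξ` the components are Fourier coefficients of one row vector in the orthonormal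
  -- family `𝓕 e_i`. Bessel's inequality bounds each of the `2^N` components.
  have h1 : ∀ i j, ‖fourierL2 (moyalRep θ f (e i)) ξ j‖ ^ 2 =
      ‖inner ℂ (fourierL2 (e i)) (kernelVec θ f ξ (EuclideanSpace.single j 1))‖ ^ 2 := by
    intro i j
    rw [norm_inner_symm, ← h, EuclideanSpace.inner_single_left, map_one, one_mul]
  simp only [EuclideanSpace.norm_sq_eq, h1]
  rw [Finset.sum_comm]
  calc _ ≤ ∑ _j : Fin (2 ^ N), ‖(𝓕 f).toLp 2 volume‖ ^ 2 := by
        refine Finset.sum_le_sum fun j _ => (hF.sum_inner_products_le _).trans (le_of_eq ?_)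
        rw [norm_kernelVec, PiLp.norm_single, norm_one, one_mul]
    _ = _ := by simp

end Kernel

/-! ### The momentum integral and the partial-trace estimate -/

theorem integrable_norm_sq_coeFn {α F : Type*} [MeasurableSpace α] {μ : Measure α}
    [NormedAddCommGroup F] (x : Lp F 2 μ) : Integrable (fun a => ‖x a‖ ^ 2) μ :=
  (memLp_two_iff_integrable_sq_norm (Lp.aestronglyMeasurable x)).mp (Lp.memLp x)

theorem norm_sq_eq_integral {α F : Type*} [MeasurableSpace α] {μ : Measure α}
    [NormedAddCommGroup F] [InnerProductSpace ℂ F] (x : Lp F 2 μ) :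
    ‖x‖ ^ 2 = ∫ a, ‖x a‖ ^ 2 ∂μ := by
  have h : ((‖x‖ ^ 2 : ℝ) : ℂ) = ((∫ a, ‖x a‖ ^ 2 ∂μ : ℝ) : ℂ) := by
    rw [← integral_complex_ofReal]
    have h1 := inner_self_eq_norm_sq_to_K (𝕜 := ℂ) x
    rw [L2.inner_def] at h1
    simp only [inner_self_eq_norm_sq_to_K] at h1
    push_cast
    exact h1.symm
  exact_mod_cast h

theorem integrable_indicator_inv_norm {V : Type*} [NormedAddCommGroup V] [InnerProductSpace ℝ V]
    [FiniteDimensional ℝ V] [MeasurableSpace V] [BorelSpace V] {ε : ℝ} (hε : 0 < ε) (Λ : ℝ) :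
    Integrable (fun ξ : V => (Set.Iic Λ).indicator (fun r => (2 * Real.pi * r + ε)⁻¹) ‖ξ‖)
      volume := by
  have h1 : (fun ξ : V => (Set.Iic Λ).indicator (fun r => (2 * Real.pi * r + ε)⁻¹) ‖ξ‖) =
      (Metric.closedBall (0 : V) Λ).indicator fun ξ => (2 * Real.pi * ‖ξ‖ + ε)⁻¹ := by
    funext ξ
    simp only [Set.indicator, Set.mem_Iic, Metric.mem_closedBall, dist_zero_right]
  rw [h1]
  refine IntegrableOn.integrable_indicator ?_ Metric.isClosed_closedBall.measurableSet
  refine ContinuousOn.integrableOn_compact (isCompact_closedBall _ _) (Continuous.continuousOn ?_)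
  exact Continuous.inv₀ (by fun_prop) fun ξ => by positivity

/-- In polar coordinates the radial integrand is at most `r^{d-2} / (2π) ≤ Λ^{d-2} / (2π)` on an
interval of length `Λ`. Dimension at least two keeps the exponent `d - 2` nonnegative. -/
theorem integral_indicator_inv_norm_le {V : Type*} [NormedAddCommGroup V] [InnerProductSpace ℝ V]
    [FiniteDimensional ℝ V] [MeasurableSpace V] [BorelSpace V] (hd : 2 ≤ Module.finrank ℝ V) :
    ∃ C : ℝ, 0 ≤ C ∧ ∀ ε : ℝ, 0 < ε → ∀ Λ : ℝ, 1 ≤ Λ →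
      ∫ ξ : V, (Set.Iic Λ).indicator (fun r => (2 * Real.pi * r + ε)⁻¹) ‖ξ‖ ≤
        C * Λ ^ (Module.finrank ℝ V - 1) := by
  have : Nontrivial V := Module.nontrivial_of_finrank_pos (R := ℝ) (by lia)
  set d := Module.finrank ℝ V with hd_def
  refine ⟨d * (volume.real (Metric.ball (0 : V) 1) * (2 * Real.pi)⁻¹), by positivity,
    fun ε hε Λ hΛ => ?_⟩
  have hΛ0 : 0 < Λ := by linarith
  rw [integral_fun_norm_addHaar volume
    (fun r => (Set.Iic Λ).indicator (fun r => (2 * Real.pi * r + ε)⁻¹) r), nsmul_eq_mul,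
    smul_eq_mul, mul_assoc, mul_assoc]
  have hrad : ∫ y in Set.Ioi (0 : ℝ),
      y ^ (d - 1) • (Set.Iic Λ).indicator (fun r => (2 * Real.pi * r + ε)⁻¹) y ≤
      (2 * Real.pi)⁻¹ * Λ ^ (d - 1) := by
    calc _ ≤ ∫ y in Set.Ioi (0 : ℝ),
          (Set.Iic Λ).indicator (fun _ => (2 * Real.pi)⁻¹ * Λ ^ (d - 2)) y := by
          refine integral_mono_of_nonneg ?_ ?_ ?_
          · filter_upwards [ae_restrict_mem measurableSet_Ioi] with y hy
            have hy0 : (0 : ℝ) < y := hy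
            refine smul_nonneg (by positivity) (Set.indicator_apply_nonneg fun _ => ?_)
            positivity
          · rw [integrable_indicator_iff measurableSet_Iic, IntegrableOn,
              Measure.restrict_restrict measurableSet_Iic, Set.Iic_inter_Ioi]
            exact integrableOn_const measure_Ioc_lt_top.ne
          · filter_upwards [ae_restrict_mem measurableSet_Ioi] with y hy
            have hy0 : (0 : ℝ) < y := hy
            by_cases hyΛ : y ∈ Set.Iic Λ
            · rw [Set.indicator_of_mem hyΛ, Set.indicator_of_mem hyΛ, smul_eq_mul]
              have hyΛ' : y ≤ Λ := hyΛ
              have e : d - 1 = (d - 2) + 1 := by lia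
              rw [e, pow_succ, mul_assoc, mul_comm]
              refine mul_le_mul ?_ (pow_le_pow_left₀ hy0.le hyΛ' _) (by positivity) (by positivity)
              have hpi := Real.pi_pos
              rw [← div_eq_mul_inv, div_le_iff₀ (by positivity), inv_mul_eq_div,
                le_div_iff₀ (by positivity)]
              nlinarith
            · rw [Set.indicator_of_notMem hyΛ, Set.indicator_of_notMem hyΛ, smul_zero]
      _ = (2 * Real.pi)⁻¹ * Λ ^ (d - 1) := by
          rw [setIntegral_indicator measurableSet_Iic, Set.Ioi_inter_Iic, setIntegral_const,
            measureReal_def, Real.volume_Ioc, sub_zero, ENNReal.toReal_ofReal hΛ0.le, smul_eq_mul]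
          have e : d - 1 = (d - 2) + 1 := by lia
          rw [e, pow_succ]
          ring
  gcongr

theorem memLp_top_sqrt_inv {V : Type*} [NormedAddCommGroup V] [InnerProductSpace ℝ V]
    [FiniteDimensional ℝ V] [MeasurableSpace V] [BorelSpace V] {ε : ℝ} (hε : 0 < ε) :
    MemLp (fun ξ : V => ((√((2 * Real.pi * ‖ξ‖ + ε)⁻¹) : ℝ) : ℂ)) ∞ volume ∧
    MemLp (fun ξ : V => (((2 * Real.pi * ‖ξ‖ + ε)⁻¹ : ℝ) : ℂ)) ∞ volume := by
  have hc : Continuous fun ξ : V => (2 * Real.pi * ‖ξ‖ + ε)⁻¹ :=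
    Continuous.inv₀ (by fun_prop) fun ξ => by positivity
  have hle : ∀ ξ : V, (2 * Real.pi * ‖ξ‖ + ε)⁻¹ ≤ ε⁻¹ := fun ξ => by
    gcongr
    have := Real.pi_pos
    have : 0 ≤ 2 * Real.pi * ‖ξ‖ := by positivity
    linarith
  constructor
  · refine memLp_top_of_bound (by fun_prop) (√ε⁻¹) (Eventually.of_forall fun ξ => ?_)
    rw [Complex.norm_real, Real.norm_of_nonneg (Real.sqrt_nonneg _)]
    exact Real.sqrt_le_sqrt (hle ξ)
  · refine memLp_top_of_bound (by fun_prop) ε⁻¹ (Eventually.of_forall fun ξ => ?_)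
    rw [Complex.norm_real, Real.norm_of_nonneg (by positivity)]
    exact hle ξ

/-- Partial traces of `π(f)^* (|D| + ε)^{-1} π(f)`, split at the momentum `Λ`. -/
theorem sum_norm_sq_fourierMul_moyalRep_le {N : ℕ} (hN : 1 ≤ N) (θ : ℝ) {ε : ℝ} (hε : 0 < ε)
    (f : 𝓢(Plane N, ℂ)) : ∃ K : ℝ, 0 ≤ K ∧ ∀ Λ : ℝ, 1 ≤ Λ → ∀ (n : ℕ) (e : Fin n → Spinors N),
      Orthonormal ℂ e →
      ∑ i, ‖(fourierMul (Fibre N) (memLp_top_sqrt_inv (V := Plane N) hε).1 ∘L moyalRep θ f)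
        (e i)‖ ^ 2 ≤ K * (n / Λ + Λ ^ (2 * N - 1)) := by
  have hdim : Module.finrank ℝ (Plane N) = 2 * N := by simp [two_mul]
  obtain ⟨C, hC0, hC⟩ := integral_indicator_inv_norm_le (V := Plane N) (by rw [hdim]; lia)
  rw [hdim] at hC
  set A : ℝ := 2 ^ N * ‖(𝓕 f).toLp 2 volume‖ ^ 2 with hA
  have hA0 : 0 ≤ A := by positivity
  have hpi := Real.pi_pos
  -- `A * C` comes from momenta below `Λ`, `‖moyalRep θ f‖ ^ 2` from those above; adding them gives
  -- one constant for both terms.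
  refine ⟨A * C + ‖moyalRep θ f‖ ^ 2, by positivity, fun Λ hΛ n e he => ?_⟩
  have hΛ0 : 0 < Λ := by linarith
  set g : Plane N → ℝ := fun ξ => (2 * Real.pi * ‖ξ‖ + ε)⁻¹ with hg
  set w : Plane N → ℝ := fun ξ => (Set.Iic Λ).indicator (fun r => (2 * Real.pi * r + ε)⁻¹) ‖ξ‖
    with hw
  set s : Plane N → ℝ := fun ξ => ∑ i, ‖fourierL2 (moyalRep θ f (e i)) ξ‖ ^ 2 with hs
  have hg0 : ∀ ξ, 0 ≤ g ξ := fun ξ => by positivity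
  have hs0 : ∀ ξ, 0 ≤ s ξ := fun ξ => Finset.sum_nonneg fun i _ => sq_nonneg _
  have hsi : Integrable s volume := integrable_finsetSum _ fun i _ => integrable_norm_sq_coeFn _
  have hsint : ∫ ξ, s ξ ≤ n * ‖moyalRep θ f‖ ^ 2 := by
    rw [hs, integral_finsetSum _ fun i _ => integrable_norm_sq_coeFn _]
    calc _ ≤ ∑ _i : Fin n, ‖moyalRep θ f‖ ^ 2 := by
          refine Finset.sum_le_sum fun i _ => ?_
          rw [← norm_sq_eq_integral, norm_fourierL2]
          have := (moyalRep θ f).le_opNorm (e i)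
          rw [he.1 i, mul_one] at this
          gcongr
      _ = _ := by simp
  have hgs : ∑ i, ‖(fourierMul (Fibre N) (memLp_top_sqrt_inv (V := Plane N) hε).1 ∘L
      moyalRep θ f) (e i)‖ ^ 2 = ∫ ξ, g ξ * s ξ := by
    have hi : ∀ i, (fun ξ => ‖fourierL2 ((fourierMul (Fibre N)
        (memLp_top_sqrt_inv (V := Plane N) hε).1 ∘L moyalRep θ f) (e i)) ξ‖ ^ 2) =ᵐ[volume]
        fun ξ => g ξ * ‖fourierL2 (moyalRep θ f (e i)) ξ‖ ^ 2 := by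
      intro i
      filter_upwards [fourier_fourierMul (memLp_top_sqrt_inv (V := Plane N) hε).1
        (moyalRep θ f (e i))] with ξ h1
      rw [ContinuousLinearMap.comp_apply, h1, norm_smul, mul_pow, Complex.norm_real,
        Real.norm_of_nonneg (Real.sqrt_nonneg _), Real.sq_sqrt (hg0 ξ)]
    simp only [hs, Finset.mul_sum]
    rw [integral_finsetSum _ fun i _ => (integrable_norm_sq_coeFn _).congr (hi i)]
    refine Finset.sum_congr rfl fun i _ => ?_
    rw [← norm_fourierL2, norm_sq_eq_integral]
    exact integral_congr_ae (hi i)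
  rw [hgs]
  -- Below `Λ` the Bessel bound `s ≤ A` is used; above it, `2π‖ξ‖ + ε ≥ Λ`.
  have hbound : ∀ᵐ ξ, g ξ * s ξ ≤ A * w ξ + Λ⁻¹ * s ξ := by
    filter_upwards [sum_norm_sq_fourierL2_moyalRep_le θ f he] with ξ h1
    by_cases hξ : ‖ξ‖ ∈ Set.Iic Λ
    · have h2 : w ξ = g ξ := by rw [hw]; exact Set.indicator_of_mem hξ _
      rw [h2]
      have h3 : g ξ * s ξ ≤ g ξ * A := mul_le_mul_of_nonneg_left h1 (hg0 ξ)
      have h4 : 0 ≤ Λ⁻¹ * s ξ := mul_nonneg (by positivity) (hs0 ξ)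
      linarith [mul_comm (g ξ) A]
    · have h2 : w ξ = 0 := by rw [hw]; exact Set.indicator_of_notMem hξ _
      rw [h2, mul_zero, zero_add]
      refine mul_le_mul_of_nonneg_right ?_ (hs0 ξ)
      have hξ' : Λ < ‖ξ‖ := not_le.mp hξ
      rw [hg]
      refine inv_anti₀ hΛ0 ?_
      nlinarith [Real.pi_gt_three]
  have hwi := integrable_indicator_inv_norm (V := Plane N) hε Λ
  calc ∫ ξ, g ξ * s ξ ≤ ∫ ξ, A * w ξ + Λ⁻¹ * s ξ :=
        integral_mono_of_nonneg (Eventually.of_forall fun ξ => mul_nonneg (hg0 ξ) (hs0 ξ))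
          ((hwi.const_mul A).add (hsi.const_mul _)) hbound
    _ = A * (∫ ξ, w ξ) + Λ⁻¹ * ∫ ξ, s ξ := by
        rw [integral_add (hwi.const_mul A) (hsi.const_mul _), integral_const_mul,
          integral_const_mul]
    _ ≤ A * (C * Λ ^ (2 * N - 1)) + Λ⁻¹ * (n * ‖moyalRep θ f‖ ^ 2) := by
        gcongr
        exact hC ε hε Λ hΛ
    _ ≤ _ := by
        have h1 : 0 ≤ A * C * (n / Λ) := by positivity
        have h2 : 0 ≤ ‖moyalRep θ f‖ ^ 2 * Λ ^ (2 * N - 1) := by positivity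
        rw [div_eq_inv_mul] at h1 ⊢
        nlinarith

end Moyal

end

theorem mainTheorem6 {N : ℕ} (hN : 1 ≤ N)
    (γ : Fin N ⊕ Fin N → Matrix (Fin (2 ^ N)) (Fin (2 ^ N)) ℂ) (hγ : Moyal.IsDirac γ)
    (θ : ℝ) {ε : ℝ} (hε : 0 < ε) (f : SchwartzMap (Moyal.Plane N) ℂ) :
    ∃ (A : Moyal.Spinors N →ₗ.[ℂ] Moyal.Spinors N) (R : Moyal.Spinors N →L[ℂ] Moyal.Spinors N),
      Moyal.IsModulus (Moyal.dirac γ) A ∧ Moyal.IsShiftInverse A ε R ∧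
      Moyal.MemWeakSchatten (2 * N)
        (Moyal.moyalRep θ f ∘L R ∘L Moyal.moyalRep θ (Moyal.conj f)) := by
  have hm := Moyal.memLp_top_sqrt_inv (V := Moyal.Plane N) hε
  have hpi := Real.pi_pos
  refine ⟨_, Moyal.fourierMul (Moyal.Fibre N) hm.2, Moyal.isModulus_dirac hγ,
    Moyal.isShiftInverse_fourierMul (fun ξ => by positivity) hm.2, ?_⟩
  -- The estimate is applied to `f^*`, so that `B^* B` has `π^θ(f)` on the left and `π^θ(f^*)` on
  -- the right.
  obtain ⟨K, hK, hB⟩ := Moyal.sum_norm_sq_fourierMul_moyalRep_le hN θ hε (Moyal.conj f)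
  have h := Moyal.memWeakSchatten_adjoint_comp_self _ (d := 2 * N) (by lia) hK hB
  have hsq : Moyal.fourierMul (Moyal.Fibre N) hm.1 ∘L Moyal.fourierMul (Moyal.Fibre N) hm.1 =
      Moyal.fourierMul (Moyal.Fibre N) hm.2 := by
    refine Moyal.fourierMul_comp _ _ _ fun ξ => ?_
    rw [← Complex.ofReal_mul, Real.mul_self_sqrt (by positivity)]
  rw [ContinuousLinearMap.adjoint_comp, Moyal.fourierMul_adjoint, Moyal.moyalRep_conj,
    ContinuousLinearMap.adjoint_adjoint, ContinuousLinearMap.comp_assoc,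
    ← ContinuousLinearMap.comp_assoc _ _ (Moyal.moyalRep θ f).adjoint, hsq] at h
  rw [Moyal.moyalRep_conj]
  rw [Nat.cast_mul, Nat.cast_ofNat] at h
  exact h
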